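/- **Setting.** Let $(\Omega,\mathcal F,P)$ be a complete probability space with a filtration $(\mathcal F_t)_{t\ge0}$ satisfying the usual conditions, let $H$ and $G$ be separable real Hilbert spaces, $U$ a topological space, and $T>0$. $\mathcal L_2(H,G)$ denotes the Hilbert–Schmidt operators. For a continuous Hilbertian seminorm $q$ on $H$, $H_q$ is the Hilbert space completion of $(H/\ker q,q)$ and $i_q:H\to H_q$ is the canonical map. $\mathcal M^2_T(G)$ is the space of $G$-valued mean-zero càdlàg square integrable martingales on $[0,T]$ (indistinguishable processes are identified) with norm $\|X\|_{\mathcal M^2_T(G)}=(E\sup_{t\le T}\|X_t\|^2)^{1/2}$. Let $\mathcal R$ be a ring of sets generating $\mathcal B(U)$ and let $M=(M(t,A):t\ge0,A\in\mathcal R)$ be a cylindrical martingale-valued measure in $H$: a family of linear maps $M(t,A):H\to L^0(\Omega,\mathcal F,P)$ such that, a.s. equalities being understood, 1. $M(0,A)(h)=0$ for all $A\in\mathcal R$, $h\in H$; 2. $M(t,\emptyset)(h)=0$, and $M(t,A\cup B)(h)=M(t,A)(h)+M(t,B)(h)$ for disjoint $A,B\in\mathcal R$; 3. for all $A\in\mathcal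 R$ and $h\in H$, $(M(t,A)(h))_{t\ge0}$ is a real mean-zero square integrable martingale, and $M(t,A):H\to L^0$ is continuous for convergence in probability; 4. $E[M(t,A)(h_1)M(s,B)(h_2)]=0$ for disjoint $A,B\in\mathcal R$ and all $t,s\ge0$, $h_1,h_2\in H$; 5. writing $M((s,t],A)=M(t,A)-M(s,A)$, for all $0\le s<t$, $A,B\in\mathcal R$, $h_1,h_2\in H$ the random vector $\big(M((s,t],A)(h_1),M((s,t],B)(h_2)\big)$ is independent of $\mathcal F_s$; 6. for all $A\in\mathcal R$, $0\le s<t$, $h\in H$: $E|M((s,t],A)(h)|^2=\int_{(s,t]}\int_A q_{r,u}(h)^2\,\mu(du)\,\lambda(dr)$, where $\mu$ is a $\sigma$-finite Borel measure on $U$, finite on $\mathcal R$, $\lambda$ is a Borel measure on $\mathbb R_+$, finite on bounded intervals, and $(q_{r,u})$ are continuous Hilbertian seminorms on $H$ such that for all $h_1,h_2\in H$ the associated bilinear forms $(r,u)\mapsto q_{r,u}(h_1,h_2)$ are jointly measurable and bounded on $[0,T']\times U$ for every $T'>0$. **Simple integrands.** $\mathcal S(M,T)$ is the vector space of families $$\Phi(r,\omega,u)=\sum_{i=1}^n\sum_{j=1}^m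 1_{]s_i,t_i]}(r)\,1_{F_i}(\omega)\,1_{A_j}(u)\;S_{i,j}\circ i^*_{q_{r,u}}\qquad(r\in[0,T],\ \omega\in\Omega,\ u\in U),\tag{a}$$ with $0\le s_i<t_i\le T$, $F_i\in\mathcal F_{s_i}$, $A_j\in\mathcal R$, $S_{i,j}\in\mathcal L_2(H,G)$, with the (semi)norm given by $\|\Phi\|^2_{\Lambda^2(M,T)}=E\int_0^T\!\int_U\|\Phi(r,u)\|^2_{\mathcal L_2(H_{q_{r,u}},G)}\,\mu(du)\,\lambda(dr)$. The representation (a) is called separated if, whenever $k\ne l$ and $]s_k,t_k]\cap]s_l,t_l]\neq\emptyset$, one has $]s_k,t_k]=]s_l,t_l]$ and $F_k\cap F_l=\emptyset$. **Radonified processes.** For $0\le s<t\le T$, $A\in\mathcal R$ and $S\in\mathcal L_2(H,G)$, $Y(s,t,A,S)$ denotes a $G$-valued càdlàg square integrable martingale on $[0,T]$ such that, for all $r\in[0,T]$ and $g\in G$, a.s. $\langle Y_r(s,t,A,S),g\rangle=M((s\wedge r,t\wedge r],A)(S^*g)$. **Theorem.** The process $Y(s,t,A,S)$ exists for all such $s,t,A,S$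 and is unique up to indistinguishability. Every $\Phi\in\mathcal S(M,T)$ has a separated representation, and the process $$I_t(\Phi)=\sum_{i=1}^n\sum_{j=1}^m 1_{F_i}\,Y_t(s_i,t_i,A_j,S_{i,j}),\qquad t\in[0,T],$$ does not depend, up to indistinguishability, on the separated representation (a) of $\Phi$ by which it is computed. For every $\Phi\in\mathcal S(M,T)$ one has $I(\Phi)\in\mathcal M^2_T(G)$, and for every $t\in[0,T]$ $$E\,I_t(\Phi)=0,\qquad E\|I_t(\Phi)\|^2=E\int_0^t\!\int_U\|\Phi(r,u)\|^2_{\mathcal L_2(H_{q_{r,u}},G)}\,\mu(du)\,\lambda(dr),$$ where $\int_0^t=\int_{(0,t]}$. In particular $I:\mathcal S(M,T)\to\mathcal M^2_T(G)$ is linear and continuous, i.e. linear with $\|I(\Phi)\|_{\mathcal M^2_T(G)}\le C\|\Phi\|_{\Lambda^2(M,T)}$ for some constant $C$ and all $\Phi$. -/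

import Mathlib

open MeasureTheory ProbabilityTheory Filter Topology Set
open scoped NNReal ENNReal RealInnerProductSpace

noncomputable section

/-! ### Hilbert–Schmidt operators -/

section HilbertSchmidt

variable {E F : Type*} [NormedAddCommGroup E] [InnerProductSpace ℝ E] [CompleteSpace E]
  [NormedAddCommGroup F] [InnerProductSpace ℝ F]

/-- A chosen complete orthonormal system of a Hilbert space. -/
def chosenONB (E : Type*) [NormedAddCommGroup E] [InnerProductSpace ℝ E] [CompleteSpace E] :
    Set E :=
  (exists_hilbertBasis ℝ E).choose

/-- The squared Hilbert–Schmidt norm `∑ₙ ‖S eₙ‖²`, with values in `[0, ∞]`. It does not depend on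
the complete orthonormal system, see `hsNormSq_eq_tsum`. -/
def hsNormSq (S : E →L[ℝ] F) : ℝ≥0∞ := ∑' e : chosenONB E, ‖S (e : E)‖ₑ ^ 2

/-- `S` belongs to `L₂(E, F)`. -/
def IsHilbertSchmidt (S : E →L[ℝ] F) : Prop := hsNormSq S < ∞

theorem enorm_sq_eq_tsum_inner {V ι : Type*} [NormedAddCommGroup V] [InnerProductSpace ℝ V]
    (b : HilbertBasis ι ℝ V) (x : V) :
    ‖x‖ₑ ^ 2 = ∑' i, ‖⟪x, b i⟫‖ₑ ^ 2 := by
  have h := b.hasSum_inner_mul_inner x x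
  have h2 : (fun i => ⟪x, b i⟫ * ⟪b i, x⟫) = fun i => ‖⟪x, b i⟫‖ ^ 2 := by
    funext i
    rw [real_inner_comm x (b i), Real.norm_eq_abs, sq_abs, sq]
  rw [h2, real_inner_self_eq_norm_sq] at h
  have h3 : ∀ y : ℝ, ‖y‖ₑ ^ 2 = ENNReal.ofReal (‖y‖ ^ 2) := fun y => by
    rw [← ofReal_norm, ENNReal.ofReal_pow (norm_nonneg _)]
  simp_rw [h3]
  rw [← ENNReal.ofReal_tsum_of_nonneg (fun i => by positivity) h.summable, h.tsum_eq,
    ← ofReal_norm, ENNReal.ofReal_pow (norm_nonneg _)]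

theorem tsum_enorm_sq_eq_adjoint [CompleteSpace F] {ι κ : Type*} (b : HilbertBasis ι ℝ E) (c : HilbertBasis κ ℝ F)
    (S : E →L[ℝ] F) :
    ∑' i, ‖S (b i)‖ₑ ^ 2 = ∑' k, ‖ContinuousLinearMap.adjoint S (c k)‖ₑ ^ 2 := by
  simp_rw [enorm_sq_eq_tsum_inner c (S _),
    enorm_sq_eq_tsum_inner b (ContinuousLinearMap.adjoint S _),
    ContinuousLinearMap.adjoint_inner_left]
  rw [ENNReal.tsum_comm]
  simp_rw [real_inner_comm]

/-- The Hilbert–Schmidt norm can be computed in any complete orthonormal system. -/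
theorem hsNormSq_eq_tsum [CompleteSpace F] {ι : Type*} (b : HilbertBasis ι ℝ E) (S : E →L[ℝ] F) :
    hsNormSq S = ∑' i, ‖S (b i)‖ₑ ^ 2 := by
  obtain ⟨e, he⟩ := (exists_hilbertBasis ℝ E).choose_spec
  obtain ⟨w, c, -⟩ := exists_hilbertBasis ℝ F
  rw [tsum_enorm_sq_eq_adjoint b c, ← tsum_enorm_sq_eq_adjoint e c, he]
  rfl

theorem IsHilbertSchmidt.zero : IsHilbertSchmidt (0 : E →L[ℝ] F) := by
  simp [IsHilbertSchmidt, hsNormSq]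

theorem IsHilbertSchmidt.smul {S : E →L[ℝ] F} (hS : IsHilbertSchmidt S) (a : ℝ) :
    IsHilbertSchmidt (a • S) := by
  unfold IsHilbertSchmidt hsNormSq at *
  simp only [_root_.smul_apply, enorm_smul, mul_pow, ENNReal.tsum_mul_left]
  exact ENNReal.mul_lt_top (by simp) hS

end HilbertSchmidt

/-! ### Continuous Hilbertian seminorms and their Hilbert spaces -/

/-- A continuous Hilbertian seminorm on `H`, given by its positive symmetric bilinear form. -/
structure HilbertianSeminorm (H : Type*) [NormedAddCommGroup H] [InnerProductSpace ℝ H] where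
  form : H →ₗ[ℝ] H →ₗ[ℝ] ℝ
  symm : ∀ x y, form x y = form y x
  nonneg : ∀ x, 0 ≤ form x x
  continuous_sqrt : Continuous fun x => √(form x x)

namespace HilbertianSeminorm

variable {H : Type*} [NormedAddCommGroup H] [InnerProductSpace ℝ H]

/-- The value `q(h)` of the seminorm. -/
def val (q : HilbertianSeminorm H) (h : H) : ℝ := √(q.form h h)

/-- The vector space `H` carrying the seminorm `q` instead of its norm. -/
def Pre (_q : HilbertianSeminorm H) : Type _ := H

instance (q : HilbertianSeminorm H) : AddCommGroup q.Pre := inferInstanceAs (AddCommGroup H)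

instance (q : HilbertianSeminorm H) : Module ℝ q.Pre := inferInstanceAs (Module ℝ H)

@[reducible] def core (q : HilbertianSeminorm H) : PreInnerProductSpace.Core ℝ q.Pre where
  inner x y := q.form x y
  conj_inner_symm x y := q.symm y x
  re_inner_nonneg x := q.nonneg x
  add_left x y z := by
    exact q.form.map_add₂ (x : H) (y : H) (z : H)
  smul_left x y r := by
    exact q.form.map_smul₂ r (x : H) (y : H)

instance (q : HilbertianSeminorm H) : SeminormedAddCommGroup q.Pre :=
  @InnerProductSpace.Core.toSeminormedAddCommGroup ℝ q.Pre _ _ _ q.core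

instance (q : HilbertianSeminorm H) : InnerProductSpace ℝ q.Pre :=
  InnerProductSpace.ofCore q.core

/-- The Hilbert space `H_q`: the Hausdorff completion of `(H, q)`, that is, the completion of the
pre-Hilbert space `H / ker q`. -/
abbrev Space (q : HilbertianSeminorm H) : Type _ := UniformSpace.Completion q.Pre

/-- The identity of `H`, as a continuous linear map from `H` to `(H, q)`. -/
def toPre (q : HilbertianSeminorm H) : H →L[ℝ] q.Pre where
  toFun h := h
  map_add' _ _ := rfl
  map_smul' _ _ := rfl
  cont := by
    let f : H →+ q.Pre := { toFun := fun h => h, map_zero' := rfl, map_add' := fun _ _ => rfl }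
    change Continuous f
    refine continuous_of_continuousAt_zero f ?_
    have h : Tendsto (fun x => √(q.form x x)) (𝓝 0) (𝓝 0) := by
      simpa using q.continuous_sqrt.tendsto 0
    unfold ContinuousAt
    rw [map_zero]
    exact tendsto_zero_iff_norm_tendsto_zero.mpr h

/-- The canonical map `i_q : H → H_q`. -/
def incl (q : HilbertianSeminorm H) : H →L[ℝ] q.Space :=
  (UniformSpace.Completion.toComplL : q.Pre →L[ℝ] q.Space).comp q.toPre

theorem norm_incl (q : HilbertianSeminorm H) (h : H) : ‖q.incl h‖ = q.val h :=
  UniformSpace.Completion.norm_coe (E := q.Pre) _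

end HilbertianSeminorm

/-! ### Square integrable càdlàg martingales on `[0, T]` -/

section Martingales

variable {Ω : Type*} {mΩ : MeasurableSpace Ω}

/-- The usual conditions: right continuity, and `𝓕₀` contains every `P`-null set (measurable or
not, so that `P` is complete). -/
structure UsualConditions (P : Measure Ω) (ℱ : Filtration ℝ≥0 mΩ) : Prop where
  rightContinuous : ℱ.IsRightContinuous
  null_mem : ∀ N : Set Ω, P N = 0 → MeasurableSet[ℱ 0] N

/-- The restriction of a filtration to the time interval `[0, T]`. -/
def restrictTime (ℱ : Filtration ℝ≥0 mΩ) (T : ℝ≥0) : Filtration (Iic T) mΩ where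
  seq t := ℱ (t : ℝ≥0)
  mono' _ _ h := ℱ.mono h
  le' t := ℱ.le t

/-- `f : [0, T] → G` is right continuous and has left limits. -/
def IsCadlag {T : ℝ≥0} {G : Type*} [TopologicalSpace G] (f : Iic T → G) : Prop :=
  ∀ t, ContinuousWithinAt f (Ici t) t ∧ ∃ l, Tendsto f (𝓝[<] t) (𝓝 l)

variable {G : Type*} [NormedAddCommGroup G] [InnerProductSpace ℝ G] [CompleteSpace G]

/-- `X` is a `G`-valued càdlàg square integrable martingale on `[0, T]`. -/
structure IsCadlagL2Martingale (P : Measure Ω) (ℱ : Filtration ℝ≥0 mΩ) (T : ℝ≥0)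
    (X : Iic T → Ω → G) : Prop where
  martingale : Martingale X (restrictTime ℱ T) P
  memLp : ∀ t, MemLp (X t) 2 P
  cadlag : ∀ ω, IsCadlag fun t => X t ω

/-- The vector space of `G`-valued mean-zero càdlàg square integrable martingales on `[0, T]`. -/
def l2Martingales (P : Measure Ω) [IsFiniteMeasure P] (ℱ : Filtration ℝ≥0 mΩ) (T : ℝ≥0)
    (G : Type*) [NormedAddCommGroup G] [InnerProductSpace ℝ G] [CompleteSpace G] :
    Submodule ℝ (Iic T → Ω → G) where
  carrier := {X | IsCadlagL2Martingale P ℱ T X ∧ ∀ t, ∫ ω, X t ω ∂P = 0}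
  zero_mem' :=
    ⟨⟨martingale_zero _ _ _, fun _ => MemLp.zero', fun _ _ =>
      ⟨continuousWithinAt_const, 0, tendsto_const_nhds⟩⟩, fun _ => by simp⟩
  add_mem' := by
    rintro X Y ⟨hX, hX0⟩ ⟨hY, hY0⟩
    refine ⟨⟨hX.martingale.add hY.martingale, fun t => (hX.memLp t).add (hY.memLp t),
      fun ω t => ⟨(hX.cadlag ω t).1.add (hY.cadlag ω t).1, ?_⟩⟩, fun t => ?_⟩
    · obtain ⟨a, ha⟩ := (hX.cadlag ω t).2
      obtain ⟨b, hb⟩ := (hY.cadlag ω t).2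
      exact ⟨a + b, ha.add hb⟩
    · simp only [Pi.add_apply]
      rw [integral_add (hX.martingale.integrable t) (hY.martingale.integrable t), hX0, hY0, add_zero]
  smul_mem' := by
    rintro c X ⟨hX, hX0⟩
    refine ⟨⟨hX.martingale.smul c, fun t => (hX.memLp t).const_smul c,
      fun ω t => ⟨(hX.cadlag ω t).1.const_smul c, ?_⟩⟩, fun t => ?_⟩
    · obtain ⟨a, ha⟩ := (hX.cadlag ω t).2
      exact ⟨c • a, ha.const_smul c⟩
    · simp only [Pi.smul_apply]
      rw [integral_smul, hX0, smul_zero]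

/-- The martingales that are indistinguishable from zero. -/
def indistZero (P : Measure Ω) [IsFiniteMeasure P] (ℱ : Filtration ℝ≥0 mΩ) (T : ℝ≥0)
    (G : Type*) [NormedAddCommGroup G] [InnerProductSpace ℝ G] [CompleteSpace G] :
    Submodule ℝ (l2Martingales P ℱ T G) where
  carrier := {X | ∀ᵐ ω ∂P, ∀ t, (X : Iic T → Ω → G) t ω = 0}
  zero_mem' := by simp
  add_mem' := by
    intro X Y hX hY
    change ∀ᵐ ω ∂P, ∀ t, ((X + Y : l2Martingales P ℱ T G) : Iic T → Ω → G) t ω = 0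
    filter_upwards [hX, hY] with ω h1 h2 t
    simp [h1 t, h2 t]
  smul_mem' := by
    intro c X hX
    change ∀ᵐ ω ∂P, ∀ t, ((c • X : l2Martingales P ℱ T G) : Iic T → Ω → G) t ω = 0
    filter_upwards [hX] with ω h1 t
    simp [h1 t]

/-- The space `M²_T(G)` of `G`-valued mean-zero càdlàg square integrable martingales on `[0, T]`,
two indistinguishable processes being identified. -/
abbrev M2 (P : Measure Ω) [IsFiniteMeasure P] (ℱ : Filtration ℝ≥0 mΩ) (T : ℝ≥0)
    (G : Type*) [NormedAddCommGroup G] [InnerProductSpace ℝ G] [CompleteSpace G] : Type _ :=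
  l2Martingales P ℱ T G ⧸ indistZero P ℱ T G

/-- The norm `(E sup_{t ≤ T} ‖X_t‖²)^{1/2}` of `M²_T(G)`, with values in `[0, ∞]`. -/
def M2.norm {P : Measure Ω} [IsFiniteMeasure P] {ℱ : Filtration ℝ≥0 mΩ} {T : ℝ≥0}
    (X : M2 P ℱ T G) : ℝ≥0∞ :=
  Quotient.liftOn' X
    (fun X => (∫⁻ ω, ⨆ t, ‖(X : Iic T → Ω → G) t ω‖ₑ ^ 2 ∂P) ^ (1 / 2 : ℝ)) <| by
    intro X Y h
    have h' : ∀ᵐ ω ∂P, ∀ t, ((X - Y : l2Martingales P ℱ T G) : Iic T → Ω → G) t ω = 0 :=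
      (Submodule.quotientRel_def _).mp h
    congr 1
    refine lintegral_congr_ae ?_
    filter_upwards [h'] with ω hω
    refine iSup_congr fun t => ?_
    have := hω t
    simp only [Submodule.coe_sub, Pi.sub_apply, sub_eq_zero] at this
    rw [this]

end Martingales

/-! ### Cylindrical martingale-valued measures -/

/-- A cylindrical martingale-valued measure in `H` on `ℝ₊ × ring`. A cylindrical random variable is
a linear map from `H` to the space `L⁰(Ω, P)` of classes of random variables. Only the values
`M t A` with `A ∈ ring` matter. -/
structure CylMartingaleMeasure {Ω : Type*} {mΩ : MeasurableSpace Ω} (P : Measure Ω)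
    (ℱ : Filtration ℝ≥0 mΩ) (H : Type*) [NormedAddCommGroup H] [InnerProductSpace ℝ H]
    (U : Type*) [TopologicalSpace U] [MeasurableSpace U] where
  ring : Set (Set U)
  isSetRing : IsSetRing ring
  generateFrom_ring : MeasurableSpace.generateFrom ring = borel U
  M : ℝ≥0 → Set U → H →ₗ[ℝ] (Ω →ₘ[P] ℝ)
  zero_time : ∀ A ∈ ring, ∀ h, M 0 A h = 0
  empty : ∀ t h, M t ∅ h = 0
  union : ∀ t, ∀ A ∈ ring, ∀ B ∈ ring, Disjoint A B → ∀ h, M t (A ∪ B) h = M t A h + M t B h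
  martingale : ∀ A ∈ ring, ∀ h, Martingale (fun t ω => M t A h ω) ℱ P
  memLp : ∀ A ∈ ring, ∀ t h, MemLp (M t A h) 2 P
  mean_zero : ∀ A ∈ ring, ∀ t h, ∫ ω, M t A h ω ∂P = 0
  /-- `M t A : H → L⁰` is continuous for the topology of convergence in probability. -/
  continuous : ∀ A ∈ ring, ∀ t h₀, TendstoInMeasure P (fun h => ⇑(M t A h)) (𝓝 h₀) (M t A h₀)
  orthogonal : ∀ A ∈ ring, ∀ B ∈ ring, Disjoint A B → ∀ t s h₁ h₂,
    ∫ ω, M t A h₁ ω * M s B h₂ ω ∂P = 0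
  /-- Increments on `(s, t]` are independent of `ℱ s`; this is required of pairs of increments,
  and so includes the case of a single increment. -/
  indep : ∀ s t, s < t → ∀ A ∈ ring, ∀ B ∈ ring, ∀ h₁ h₂,
    Indep (MeasurableSpace.comap
      (fun ω => ((M t A - M s A) h₁ ω, (M t B - M s B) h₂ ω)) inferInstance) (ℱ s) P
  μ : Measure U
  sigmaFinite_μ : SigmaFinite μ
  μ_lt_top : ∀ A ∈ ring, μ A < ∞
  lam : Measure ℝ≥0
  lam_lt_top : ∀ t, lam (Iic t) < ∞
  q : ℝ≥0 → U → HilbertianSeminorm H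
  measurable_q : ∀ h₁ h₂, Measurable fun p : ℝ≥0 × U => (q p.1 p.2).form h₁ h₂
  bounded_q : ∀ (T : ℝ≥0) (h₁ h₂ : H), ∃ C : ℝ, ∀ r ≤ T, ∀ u, |(q r u).form h₁ h₂| ≤ C
  covariance : ∀ A ∈ ring, ∀ s t, s < t → ∀ h,
    ∫⁻ ω, ‖(M t A - M s A) h ω‖ₑ ^ 2 ∂P
      = ∫⁻ r in Ioc s t, ∫⁻ u in A, ENNReal.ofReal ((q r u).val h ^ 2) ∂μ ∂lam

/-! ### Simple integrands and their stochastic integral -/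

namespace CylMartingaleMeasure

variable {Ω : Type*} {mΩ : MeasurableSpace Ω} {P : Measure Ω} {ℱ : Filtration ℝ≥0 mΩ}
  {H : Type*} [NormedAddCommGroup H] [InnerProductSpace ℝ H] [CompleteSpace H]
  {U : Type*} [TopologicalSpace U] [MeasurableSpace U]

/-- The cylindrical random variable `M((s, t], A)`. -/
def incr (M : CylMartingaleMeasure P ℱ H U) (s t : ℝ≥0) (A : Set U) : H →ₗ[ℝ] (Ω →ₘ[P] ℝ) :=
  M.M t A - M.M s A

/-- Families `Φ(r, ω, u)` of bounded operators from `H_{q_{r,u}}` to `G`. -/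
abbrev OpFamily (M : CylMartingaleMeasure P ℱ H U)
    (G : Type*) [NormedAddCommGroup G] [InnerProductSpace ℝ G] : Type _ :=
  ∀ (r : ℝ≥0) (_ω : Ω) (u : U), (M.q r u).Space →L[ℝ] G

/-- The data `(sᵢ, tᵢ, Fᵢ, Aⱼ, Sᵢⱼ)` in a representation of a simple integrand on `[0, T]`. -/
structure SimpleRep (M : CylMartingaleMeasure P ℱ H U) (T : ℝ≥0)
    (G : Type*) [NormedAddCommGroup G] [InnerProductSpace ℝ G] [CompleteSpace G] where
  n : ℕ
  m : ℕ
  s : Fin n → ℝ≥0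
  t : Fin n → ℝ≥0
  F : Fin n → Set Ω
  A : Fin m → Set U
  S : Fin n → Fin m → H →L[ℝ] G
  lt : ∀ i, s i < t i
  le : ∀ i, t i ≤ T
  meas_F : ∀ i, MeasurableSet[ℱ (s i)] (F i)
  mem_A : ∀ j, A j ∈ M.ring
  hs : ∀ i j, IsHilbertSchmidt (S i j)

variable {M : CylMartingaleMeasure P ℱ H U} {T : ℝ≥0}
  {G : Type*} [NormedAddCommGroup G] [InnerProductSpace ℝ G] [CompleteSpace G]

/-- The family `∑ᵢ ∑ⱼ 1_{]sᵢ, tᵢ]}(r) 1_{Fᵢ}(ω) 1_{Aⱼ}(u) Sᵢⱼ ∘ i*_{q_{r,u}}`. It vanishes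
for `r > T`. -/
def SimpleRep.toFamily (R : M.SimpleRep T G) : M.OpFamily G := fun r ω u =>
  ∑ i, ∑ j, ((Ioc (R.s i) (R.t i)).indicator (1 : ℝ≥0 → ℝ) r
    * (R.F i).indicator (1 : Ω → ℝ) ω * (R.A j).indicator (1 : U → ℝ) u) •
      (R.S i j).comp (ContinuousLinearMap.adjoint (M.q r u).incl)

/-- Time intervals that meet coincide, and then the events are disjoint. -/
def SimpleRep.IsSeparated (R : M.SimpleRep T G) : Prop :=
  ∀ k j, k ≠ j → (Ioc (R.s k) (R.t k) ∩ Ioc (R.s j) (R.t j)).Nonempty →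
    Ioc (R.s k) (R.t k) = Ioc (R.s j) (R.t j) ∧ Disjoint (R.F k) (R.F j)

variable (M T G) in
/-- The vector space `S(M, T)` of simple integrands. -/
def simpleIntegrands : Submodule ℝ (M.OpFamily G) where
  carrier := {Φ | ∃ R : M.SimpleRep T G, R.toFamily = Φ}
  zero_mem' := by
    refine ⟨⟨0, 0, Fin.elim0, Fin.elim0, Fin.elim0, Fin.elim0, fun i => i.elim0, fun i => i.elim0,
      fun i => i.elim0, fun i => i.elim0, fun i => i.elim0, fun i => i.elim0⟩, ?_⟩
    funext r ω u
    simp [SimpleRep.toFamily]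
  add_mem' := by
    rintro _ _ ⟨R, rfl⟩ ⟨R', rfl⟩
    refine ⟨⟨R.n + R'.n, R.m + R'.m, Fin.append R.s R'.s, Fin.append R.t R'.t,
      Fin.append R.F R'.F, Fin.append R.A R'.A,
      Fin.append (fun i => Fin.append (R.S i) 0) (fun i => Fin.append 0 (R'.S i)),
      ?_, ?_, ?_, ?_, ?_⟩, ?_⟩
    · intro i
      refine Fin.addCases (fun i => ?_) (fun i => ?_) i
      · simpa using R.lt i
      · simpa using R'.lt i
    · intro i
      refine Fin.addCases (fun i => ?_) (fun i => ?_) i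
      · simpa using R.le i
      · simpa using R'.le i
    · intro i
      refine Fin.addCases (fun i => ?_) (fun i => ?_) i
      · rw [Fin.append_left, Fin.append_left]
        exact R.meas_F i
      · rw [Fin.append_right, Fin.append_right]
        exact R'.meas_F i
    · intro i
      refine Fin.addCases (fun i => ?_) (fun i => ?_) i
      · simpa using R.mem_A i
      · simpa using R'.mem_A i
    · intro i j
      refine Fin.addCases (fun i => ?_) (fun i => ?_) i <;>
      refine Fin.addCases (fun j => ?_) (fun j => ?_) j
      · simpa using R.hs i j
      · simpa using IsHilbertSchmidt.zero
      · simpa using IsHilbertSchmidt.zero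
      · simpa using R'.hs i j
    · funext r ω u
      simp [SimpleRep.toFamily, Fin.sum_univ_add]
  smul_mem' := by
    rintro c _ ⟨R, rfl⟩
    refine ⟨{ R with S := fun i j => c • R.S i j, hs := fun i j => (R.hs i j).smul c }, ?_⟩
    funext r ω u
    simp only [SimpleRep.toFamily, Pi.smul_apply, Finset.smul_sum, ContinuousLinearMap.smul_comp]
    refine Finset.sum_congr rfl fun i _ => Finset.sum_congr rfl fun j _ => ?_
    rw [smul_comm]

/-- `E ∫₀ᵗ ∫_U ‖Φ(r, u)‖² μ(du) λ(dr)` with the Hilbert–Schmidt norm of `L₂(H_{q_{r,u}}, G)`. -/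
def energy (M : CylMartingaleMeasure P ℱ H U) (Φ : M.OpFamily G) (t : ℝ≥0) : ℝ≥0∞ :=
  ∫⁻ ω, ∫⁻ r in Ioc 0 t, ∫⁻ u, hsNormSq (Φ r ω u) ∂M.μ ∂M.lam ∂P

/-- The norm of `Λ²(M, T)`, with values in `[0, ∞]`. -/
def lambdaNorm (M : CylMartingaleMeasure P ℱ H U) (T : ℝ≥0) (Φ : M.OpFamily G) : ℝ≥0∞ :=
  M.energy Φ T ^ (1 / 2 : ℝ)

/-- `Y` is (a version of) the radonified process `Y(s, t, A, S)`: a `G`-valued càdlàg square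
integrable martingale with `⟪Y_r, g⟫ = M((s ∧ r, t ∧ r], A)(S* g)` almost surely. -/
structure IsRadonified (M : CylMartingaleMeasure P ℱ H U) (T s t : ℝ≥0) (A : Set U)
    (S : H →L[ℝ] G) (Y : Iic T → Ω → G) : Prop where
  isMartingale : IsCadlagL2Martingale P ℱ T Y
  version : ∀ (r : Iic T) (g : G),
    (fun ω => ⟪Y r ω, g⟫) =ᵐ[P]
      M.incr (min s r) (min t r) A (ContinuousLinearMap.adjoint S g)

/-- `X` is a stochastic integral process of `Φ`: for some separated representation of `Φ`
and some versions of the radonified processes, `X_t = ∑ᵢ ∑ⱼ 1_{Fᵢ} Y_t(sᵢ, tᵢ, Aⱼ, Sᵢⱼ)`. -/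
def IsSimpleIntegral (M : CylMartingaleMeasure P ℱ H U) (T : ℝ≥0) (Φ : M.OpFamily G)
    (X : Iic T → Ω → G) : Prop :=
  ∃ (R : M.SimpleRep T G) (Y : Fin R.n → Fin R.m → Iic T → Ω → G),
    R.IsSeparated ∧ R.toFamily = Φ ∧
    (∀ i j, M.IsRadonified T (R.s i) (R.t i) (R.A j) (R.S i j) (Y i j)) ∧
    ∀ t ω, X t ω = ∑ i, ∑ j, (R.F i).indicator (Y i j t) ω

end CylMartingaleMeasure

end

/-! The integral is built as a linear relation and shown to be a graph by an isometry. Each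
elementary integrand 1_{]s,t]} 1_F 1_A S∘i_q* is paired with 1_F Y, for any version Y of the
radonified process, and `integralRelation` is the span of these pairs. On the whole span E‖X_t‖² is
the energy of Φ on (0, t] (`lintegral_sum_process`). A process related to Φ = 0 therefore vanishes,
which gives at once independence of the representation and of the versions, and linearity; Doob's
inequality adds continuity.

The isometry reduces to scalars. The adjoint of S∘i_q* is i_q∘S*, so expanding both sides in an
orthonormal basis of G leaves covariances of variables 1_F M((s,t],A)(h). These are computed in
`integral_indicator_incr_mul_indicator_incr`: polarization treats equal sets and intervals,
orthogonality on disjoint sets reduces A, B to A ∩ B, independence of pairs of increments from the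
past factors out the events, and the martingale property removes the parts of the time intervals
that do not overlap.

For the existence of Y, the coordinates M(t,A)(S* b_k) are almost surely square summable, because S
is Hilbert–Schmidt and the forms are uniformly bounded; they define a G-valued martingale. To
regularize its paths without an order on G, upcrossings are replaced by ε-oscillations along dyadic
grids. Orthogonality of increments bounds their expected number by E‖X_T‖²/ε², uniformly in the grid
(`lintegral_greedyCount_le`), so Fatou's lemma yields one-sided limits along the dyadic points.
Right continuity in probability, which follows from λ((r,r']) → 0 as r' ↓ r, identifies the right
limits with the original process (`exists_cadlag_modification`).

Separated representations come from cutting time at all endpoints and Ω according to the set of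
active terms (`SimpleRep.refine`). -/

noncomputable section

/-! ### Square integrable martingales in discrete time -/

section Sequences

variable {G : Type*} [NormedAddCommGroup G]

/-- The last reference value of a sequence: it is updated as soon as the sequence is at a distance
of more than `ε` from it. -/
def greedyRef (ε : ℝ) (x : ℕ → G) : ℕ → G
  | 0 => x 0
  | k + 1 => if ε < ‖x (k + 1) - greedyRef ε x k‖ then x (k + 1) else greedyRef ε x k

/-- The number of updates of the reference value. -/
def greedyCount (ε : ℝ) (x : ℕ → G) : ℕ → ℕ
  | 0 => 0
  | k + 1 => greedyCount ε x k + if ε < ‖x (k + 1) - greedyRef ε x k‖ then 1 else 0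

theorem norm_sub_greedyRef_le {ε : ℝ} (hε : 0 ≤ ε) (x : ℕ → G) (k : ℕ) :
    ‖x k - greedyRef ε x k‖ ≤ ε := by
  cases k with
  | zero => simpa [greedyRef]
  | succ k =>
    rw [greedyRef]
    split_ifs with h
    · simpa
    · exact not_lt.1 h

theorem monotone_greedyCount (ε : ℝ) (x : ℕ → G) : Monotone (greedyCount ε x) :=
  monotone_nat_of_le_succ fun k => by rw [greedyCount]; exact Nat.le_add_right _ _

theorem greedyRef_eq_of_count_eq {ε : ℝ} (x : ℕ → G) {i j : ℕ} (hij : i ≤ j)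
    (h : greedyCount ε x j = greedyCount ε x i) : greedyRef ε x j = greedyRef ε x i := by
  induction j, hij using Nat.le_induction with
  | base => rfl
  | succ j hij ih =>
    have h1 := monotone_greedyCount ε x hij
    rw [greedyCount] at h
    rw [greedyRef]
    split_ifs at h ⊢ with h2
    · omega
    · exact ih (by omega)

/-- Without an update between i and j, both values lie within ε of one common reference value, hence
within 2ε of each other. -/
theorem greedyCount_add_one_le {ε : ℝ} (hε : 0 ≤ ε) (x : ℕ → G) {i j : ℕ} (hij : i ≤ j)
    (h : 2 * ε < ‖x j - x i‖) : greedyCount ε x i + 1 ≤ greedyCount ε x j := by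
  by_contra hlt
  have h1 : greedyCount ε x j = greedyCount ε x i :=
    le_antisymm (by omega) (monotone_greedyCount ε x hij)
  have h2 := norm_sub_greedyRef_le hε x j
  have h3 := norm_sub_greedyRef_le hε x i
  rw [greedyRef_eq_of_count_eq x hij h1] at h2
  have := norm_sub_le_norm_sub_add_norm_sub (x j) (greedyRef ε x i) (x i)
  rw [norm_sub_rev (greedyRef ε x i)] at this
  linarith

/-- The running maximum of the norms of a sequence. -/
def runMax (x : ℕ → G) : ℕ → ℝ
  | 0 => ‖x 0‖
  | k + 1 => max (runMax x k) ‖x (k + 1)‖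

theorem runMax_nonneg (x : ℕ → G) (k : ℕ) : 0 ≤ runMax x k := by
  induction k with
  | zero => exact norm_nonneg _
  | succ k ih => exact le_max_of_le_left ih

theorem norm_le_runMax (x : ℕ → G) {i k : ℕ} (h : i ≤ k) : ‖x i‖ ≤ runMax x k := by
  induction k, h using Nat.le_induction with
  | base => cases i with
    | zero => exact le_rfl
    | succ i => exact le_max_right _ _
  | succ k _ ih => exact le_max_of_le_left ih

variable {Ω : Type*} {mΩ : MeasurableSpace Ω} {P : Measure Ω}

theorem memLp_runMax {X : ℕ → Ω → G} (hX2 : ∀ t, MemLp (X t) 2 P) (k : ℕ) :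
    MemLp (fun ω => runMax (fun i => X i ω) k) 2 P := by
  induction k with
  | zero => exact (hX2 0).norm
  | succ k ih => exact ih.sup (hX2 (k + 1)).norm

theorem MeasureTheory.MemLp.integrable_norm_sq {f : Ω → G} (hf : MemLp f 2 P) :
    Integrable (fun ω => ‖f ω‖ ^ 2) P :=
  (memLp_two_iff_integrable_sq_norm hf.1).1 hf

theorem MeasureTheory.MemLp.lintegral_enorm_sq {f : Ω → G} (hf : MemLp f 2 P) :
    ∫⁻ ω, ‖f ω‖ₑ ^ 2 ∂P = ENNReal.ofReal (∫ ω, ‖f ω‖ ^ 2 ∂P) := by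
  rw [ofReal_integral_eq_lintegral_ofReal hf.integrable_norm_sq
    (ae_of_all _ fun _ => by positivity)]
  refine lintegral_congr fun ω => ?_
  rw [← ofReal_norm, ENNReal.ofReal_pow (norm_nonneg _)]

end Sequences

/-! ### Oscillation counts and Doob's inequality for Hilbert-space-valued martingales -/

section DiscreteMartingales

variable {Ω : Type*} {mΩ : MeasurableSpace Ω} {P : Measure Ω}
  {G : Type*} [NormedAddCommGroup G] [InnerProductSpace ℝ G]

theorem MeasureTheory.MemLp.integrable_real_inner {f g : Ω → G} (hf : MemLp f 2 P)
    (hg : MemLp g 2 P) : Integrable (fun ω => ⟪f ω, g ω⟫) P := by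
  refine (hf.norm.integrable_mul hg.norm).mono' (hf.1.inner hg.1) (ae_of_all _ fun ω => ?_)
  simpa using norm_inner_le_norm (𝕜 := ℝ) (f ω) (g ω)

variable {ℱ : Filtration ℕ mΩ} {X : ℕ → Ω → G}

theorem stronglyMeasurable_greedyRef (hX : Martingale X ℱ P) (ε : ℝ) (k : ℕ) :
    StronglyMeasurable[ℱ k] fun ω => greedyRef ε (fun i => X i ω) k := by
  induction k with
  | zero => exact hX.stronglyMeasurable 0
  | succ k ih =>
    have ih' := ih.mono (ℱ.mono k.le_succ)
    refine StronglyMeasurable.ite ?_ (hX.stronglyMeasurable (k + 1)) ih'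
    exact stronglyMeasurable_const.measurableSet_lt ((hX.stronglyMeasurable (k + 1)).sub ih').norm

theorem memLp_greedyRef (hX : Martingale X ℱ P) (hX2 : ∀ t, MemLp (X t) 2 P) (ε : ℝ) (k : ℕ) :
    MemLp (fun ω => greedyRef ε (fun i => X i ω) k) 2 P := by
  induction k with
  | zero => exact hX2 0
  | succ k ih =>
    refine ((hX2 (k + 1)).norm.add ih.norm).mono
      ((stronglyMeasurable_greedyRef hX ε (k + 1)).mono (ℱ.le _)).aestronglyMeasurable
      (ae_of_all _ fun ω => ?_)
    have : 0 ≤ ‖X (k + 1) ω‖ + ‖greedyRef ε (fun i => X i ω) k‖ := by positivity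
    simp only [greedyRef, Pi.add_apply, Real.norm_of_nonneg this]
    split_ifs <;> simp

theorem measurable_greedyCount (hX : Martingale X ℱ P) (ε : ℝ) (k : ℕ) :
    Measurable fun ω => greedyCount ε (fun i => X i ω) k := by
  induction k with
  | zero => exact measurable_const
  | succ k ih =>
    refine ih.add (Measurable.ite ?_ measurable_const measurable_const)
    exact stronglyMeasurable_const.measurableSet_lt
      (((hX.stronglyMeasurable (k + 1)).mono (ℱ.le _)).sub
        ((stronglyMeasurable_greedyRef hX ε k).mono (ℱ.le _))).norm

theorem stronglyMeasurable_runMax (hX : Martingale X ℱ P) (k : ℕ) :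
    StronglyMeasurable[ℱ k] fun ω => runMax (fun i => X i ω) k := by
  induction k with
  | zero => exact (hX.stronglyMeasurable 0).norm
  | succ k ih =>
    exact continuous_max.comp_stronglyMeasurable
      ((ih.mono (ℱ.mono k.le_succ)).prodMk (hX.stronglyMeasurable (k + 1)).norm)

variable [CompleteSpace G] [IsFiniteMeasure P]

/-- The increments of a square integrable martingale are orthogonal to the past. -/
theorem MeasureTheory.Martingale.integral_inner_increment_eq_zero {ι : Type*} [Preorder ι]
    {ℱ : Filtration ι mΩ} {X : ι → Ω → G} (hX : Martingale X ℱ P) (hX2 : ∀ t, MemLp (X t) 2 P)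
    {s t : ι} (hst : s ≤ t) {V : Ω → G} (hV : StronglyMeasurable[ℱ s] V) (hV2 : MemLp V 2 P) :
    ∫ ω, ⟪V ω, X t ω - X s ω⟫ ∂P = 0 := by
  have h2 : MemLp (fun ω => X t ω - X s ω) 2 P := (hX2 t).sub (hX2 s)
  have hint := hV2.integrable_real_inner h2
  have h1 := condExp_bilin_of_stronglyMeasurable_left (m := ℱ s) (innerSL ℝ) hV hint
    ((hX.integrable t).sub (hX.integrable s))
  have h3 : P[fun ω => X t ω - X s ω | ℱ s] =ᵐ[P] 0 := by
    refine (condExp_sub (hX.integrable t) (hX.integrable s) _).trans ?_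
    filter_upwards [hX.condExp_ae_eq hst, hX.condExp_ae_eq (le_refl s)] with ω ha hb
    simp [ha, hb]
  rw [← integral_condExp (ℱ.le s)]
  refine integral_eq_zero_of_ae ?_
  refine h1.trans ?_
  filter_upwards [h3] with ω hω
  rw [hω]; simp

/-- Pythagoras: X_t − V is the sum of X_s − V, known at time s, and of an increment orthogonal to
the past. -/
theorem MeasureTheory.Martingale.integral_norm_sub_sq {ι : Type*} [Preorder ι]
    {ℱ : Filtration ι mΩ} {X : ι → Ω → G} (hX : Martingale X ℱ P) (hX2 : ∀ t, MemLp (X t) 2 P)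
    {s t : ι} (hst : s ≤ t) {V : Ω → G} (hV : StronglyMeasurable[ℱ s] V) (hV2 : MemLp V 2 P) :
    ∫ ω, ‖X t ω - V ω‖ ^ 2 ∂P = ∫ ω, ‖X s ω - V ω‖ ^ 2 ∂P + ∫ ω, ‖X t ω - X s ω‖ ^ 2 ∂P := by
  have hW : StronglyMeasurable[ℱ s] (fun ω => X s ω - V ω) := (hX.stronglyMeasurable s).sub hV
  have hW2 : MemLp (fun ω => X s ω - V ω) 2 P := (hX2 s).sub hV2
  have hD2 : MemLp (fun ω => X t ω - X s ω) 2 P := (hX2 t).sub (hX2 s)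
  have h0 := hX.integral_inner_increment_eq_zero hX2 hst hW hW2
  have : ∀ ω, ‖X t ω - V ω‖ ^ 2 = (‖X s ω - V ω‖ ^ 2 + ‖X t ω - X s ω‖ ^ 2)
      + 2 * ⟪X s ω - V ω, X t ω - X s ω⟫ := fun ω => by
    have : X t ω - V ω = (X s ω - V ω) + (X t ω - X s ω) := by abel
    rw [this, norm_add_sq_real]; ring
  simp_rw [this]
  have h1 : Integrable (fun ω => ‖X s ω - V ω‖ ^ 2 + ‖X t ω - X s ω‖ ^ 2) P :=
    hW2.integrable_norm_sq.add hD2.integrable_norm_sq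
  rw [integral_add h1 ((hW2.integrable_real_inner hD2).const_mul 2),
    integral_add hW2.integrable_norm_sq hD2.integrable_norm_sq, integral_const_mul, h0]
  simp

/-- The expected number of `ε`-oscillations of a square integrable martingale is bounded. -/
theorem lintegral_greedyCount_le (hX : Martingale X ℱ P) (hX2 : ∀ t, MemLp (X t) 2 P) {ε : ℝ}
    (hε : 0 ≤ ε) (n : ℕ) :
    ENNReal.ofReal (ε ^ 2) * ∫⁻ ω, (greedyCount ε (fun i => X i ω) n : ℝ≥0∞) ∂P
      ≤ ∫⁻ ω, ‖X n ω‖ₑ ^ 2 ∂P := by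
  set N : ℕ → Ω → ℕ := fun k ω => greedyCount ε (fun i => X i ω) k with hN
  set R : ℕ → Ω → G := fun k ω => greedyRef ε (fun i => X i ω) k with hR
  have hNint : ∀ k, Integrable (fun ω => (N k ω : ℝ)) P := fun k => by
    refine Integrable.of_bound (C := k)
      ((measurable_from_nat.comp (measurable_greedyCount hX ε k)).aestronglyMeasurable)
      (ae_of_all _ fun ω => ?_)
    simp only [Real.norm_natCast, Nat.cast_le, hN]
    clear hN hR
    induction k with
    | zero => simp [greedyCount]
    | succ k ih => rw [greedyCount]; split_ifs <;> omega
  -- The distance to the reference value is kept in the induction as a reserve: an update resets it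
  -- to zero and so pays the ε² for the new count, while each martingale step raises both sides by
  -- the same E‖X_{k+1} − X_k‖².
  have key : ∀ k, ∫ ω, (ε ^ 2 * (N k ω : ℝ) + ‖X k ω - R k ω‖ ^ 2) ∂P
      ≤ ∫ ω, ‖X k ω‖ ^ 2 ∂P := by
    intro k
    induction k with
    | zero =>
      refine integral_mono_of_nonneg (ae_of_all _ fun ω => by positivity)
        (hX2 0).integrable_norm_sq (ae_of_all _ fun ω => ?_)
      simp [hN, hR, greedyCount, greedyRef]
    | succ k ih =>
      have hRm := stronglyMeasurable_greedyRef hX ε k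
      have hR2 := memLp_greedyRef hX hX2 ε k
      have hXR : Integrable (fun ω => ‖X (k + 1) ω - R k ω‖ ^ 2) P :=
        ((hX2 (k + 1)).sub hR2).integrable_norm_sq
      have hXR' : Integrable (fun ω => ‖X k ω - R k ω‖ ^ 2) P :=
        ((hX2 k).sub hR2).integrable_norm_sq
      calc ∫ ω, (ε ^ 2 * (N (k + 1) ω : ℝ) + ‖X (k + 1) ω - R (k + 1) ω‖ ^ 2) ∂P
          ≤ ∫ ω, (ε ^ 2 * (N k ω : ℝ) + ‖X (k + 1) ω - R k ω‖ ^ 2) ∂P := by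
            refine integral_mono_of_nonneg (ae_of_all _ fun ω => by positivity)
              (((hNint k).const_mul _).add hXR) (ae_of_all _ fun ω => ?_)
            simp only [hN, hR, greedyCount, greedyRef]
            split_ifs with h
            · have : ε ^ 2 ≤ ‖X (k + 1) ω - greedyRef ε (fun i => X i ω) k‖ ^ 2 := by gcongr
              push_cast
              simp only [sub_self, norm_zero]
              linarith
            · simp
        _ = ∫ ω, (ε ^ 2 * (N k ω : ℝ) + ‖X k ω - R k ω‖ ^ 2) ∂P
              + ∫ ω, ‖X (k + 1) ω - X k ω‖ ^ 2 ∂P := by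
            rw [integral_add ((hNint k).const_mul _) hXR,
              integral_add ((hNint k).const_mul _) hXR',
              hX.integral_norm_sub_sq hX2 k.le_succ hRm hR2, add_assoc]
        _ ≤ ∫ ω, ‖X k ω‖ ^ 2 ∂P + ∫ ω, ‖X (k + 1) ω - X k ω‖ ^ 2 ∂P := by gcongr
        _ = ∫ ω, ‖X (k + 1) ω‖ ^ 2 ∂P := by
            have := hX.integral_norm_sub_sq hX2 k.le_succ
              (V := fun _ => (0 : G)) stronglyMeasurable_const MemLp.zero'
            simp only [sub_zero] at this
            exact this.symm
  rw [(hX2 n).lintegral_enorm_sq]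
  have h1 : ∫⁻ ω, (N n ω : ℝ≥0∞) ∂P = ENNReal.ofReal (∫ ω, (N n ω : ℝ) ∂P) := by
    rw [ofReal_integral_eq_lintegral_ofReal (hNint n) (ae_of_all _ fun _ => by positivity)]
    simp
  rw [h1, ← ENNReal.ofReal_mul (by positivity), ← integral_const_mul]
  refine ENNReal.ofReal_le_ofReal (le_trans ?_ (key n))
  refine integral_mono ((hNint n).const_mul _) (((hNint n).const_mul _).add
    ((hX2 n).sub (memLp_greedyRef hX hX2 ε n)).integrable_norm_sq) fun ω => ?_
  simp

/-- Doob's `L²` maximal inequality in discrete time. -/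
theorem lintegral_runMax_sq_le (hX : Martingale X ℱ P) (hX2 : ∀ t, MemLp (X t) 2 P) (n : ℕ) :
    ∫⁻ ω, ‖runMax (fun i => X i ω) n‖ₑ ^ 2 ∂P ≤ 4 * ∫⁻ ω, ‖X n ω‖ₑ ^ 2 ∂P := by
  set S : ℕ → Ω → ℝ := fun k ω => runMax (fun i => X i ω) k with hS
  have hS2 : ∀ k, MemLp (S k) 2 P := memLp_runMax hX2
  have hS0 : ∀ k ω, 0 ≤ S k ω := fun k ω => runMax_nonneg _ k
  have hSX : ∀ k l, Integrable (fun ω => S k ω * ‖X l ω‖) P := fun k l =>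
    (hS2 k).integrable_mul (hX2 l).norm
  have hSS : ∀ k, Integrable (fun ω => S k ω ^ 2) P := fun k => (hS2 k).integrable_sq
  have hD : ∀ k, Integrable (fun ω => S k ω * ‖X k ω‖ - S k ω ^ 2 / 2) P := fun k =>
    (hSX k k).sub ((hSS k).div_const 2)
  have key : ∀ k, 0 ≤ ∫ ω, (S k ω * ‖X k ω‖ - S k ω ^ 2 / 2) ∂P := by
    intro k
    induction k with
    | zero =>
      refine integral_nonneg fun ω => ?_
      simp only [hS, runMax, Pi.zero_apply]
      nlinarith [sq_nonneg ‖X 0 ω‖]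
    | succ k ih =>
      -- S_k times the unit vector in the direction of X_k, and 0 where X_k = 0. Its inner product
      -- with the next increment is at most S_k(‖X_{k+1}‖ − ‖X_k‖) and has mean zero.
      set V : Ω → G := fun ω => (S k ω * ‖X k ω‖⁻¹) • X k ω with hV
      have hVm : StronglyMeasurable[ℱ k] V :=
        ((stronglyMeasurable_runMax hX k).mul
          (hX.stronglyMeasurable k).norm.inv₀).smul (hX.stronglyMeasurable k)
      have hV2 : MemLp V 2 P := by
        refine (hS2 k).mono (hVm.mono (ℱ.le k)).aestronglyMeasurable (ae_of_all _ fun ω => ?_)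
        rw [hV]
        simp only [norm_smul, norm_mul, norm_inv, norm_norm, mul_assoc]
        by_cases h : ‖X k ω‖ = 0
        · simp [h]
        · rw [inv_mul_cancel₀ h, mul_one]
      have h0 := hX.integral_inner_increment_eq_zero hX2 k.le_succ hVm hV2
      have hint : Integrable (fun ω => ⟪V ω, X (k + 1) ω - X k ω⟫) P :=
        hV2.integrable_real_inner ((hX2 (k + 1)).sub (hX2 k))
      calc (0 : ℝ) ≤ ∫ ω, (S k ω * ‖X k ω‖ - S k ω ^ 2 / 2) ∂P
            + ∫ ω, ⟪V ω, X (k + 1) ω - X k ω⟫ ∂P := by rw [h0, add_zero]; exact ih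
        _ = ∫ ω, ((S k ω * ‖X k ω‖ - S k ω ^ 2 / 2) + ⟪V ω, X (k + 1) ω - X k ω⟫) ∂P :=
            (integral_add (hD k) hint).symm
        _ ≤ _ := by
            refine integral_mono ((hD k).add hint) (hD (k + 1)) fun ω => ?_
            have h1 : ⟪V ω, X (k + 1) ω - X k ω⟫ ≤ S k ω * (‖X (k + 1) ω‖ - ‖X k ω‖) := by
              rw [hV]
              simp only [inner_smul_left, inner_sub_right, real_inner_self_eq_norm_sq,
                RCLike.conj_to_real, mul_assoc, ← mul_sub]
              refine mul_le_mul_of_nonneg_left ?_ (hS0 k ω)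
              by_cases h : ‖X k ω‖ = 0
              · simp [h]
              · have hp : 0 < ‖X k ω‖ := lt_of_le_of_ne (norm_nonneg _) (Ne.symm h)
                rw [inv_mul_le_iff₀ hp]
                nlinarith [real_inner_le_norm (X k ω) (X (k + 1) ω)]
            have h2 : S (k + 1) ω = max (S k ω) ‖X (k + 1) ω‖ := rfl
            have h3 := hS0 k ω
            simp only
            rcases le_total ‖X (k + 1) ω‖ (S k ω) with h | h
            · rw [h2, max_eq_left h]; linarith
            · rw [h2, max_eq_right h]; nlinarith [sq_nonneg (‖X (k + 1) ω‖ - S k ω)]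
  have hfin : ∫ ω, S n ω ^ 2 ∂P ≤ 4 * ∫ ω, ‖X n ω‖ ^ 2 ∂P := by
    have h1 := key n
    rw [integral_sub (hSX n n) ((hSS n).div_const 2), integral_div] at h1
    -- Young's inequality with weight 1/4 leaves a quarter of E S_n² on the left, whence the
    -- constant 4.
    have h2 : ∫ ω, S n ω * ‖X n ω‖ ∂P ≤ ∫ ω, (S n ω ^ 2 / 4 + ‖X n ω‖ ^ 2) ∂P :=
      integral_mono (hSX n n) (((hSS n).div_const 4).add (hX2 n).integrable_norm_sq) fun ω => by
        nlinarith [sq_nonneg (S n ω / 2 - ‖X n ω‖)]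
    rw [integral_add ((hSS n).div_const 4) (hX2 n).integrable_norm_sq, integral_div] at h2
    linarith
  rw [(hX2 n).lintegral_enorm_sq, (hS2 n).lintegral_enorm_sq,
    show (4 : ℝ≥0∞) = ENNReal.ofReal 4 by simp, ← ENNReal.ofReal_mul (by norm_num)]
  refine ENNReal.ofReal_le_ofReal ?_
  simpa using hfin

end DiscreteMartingales

/-! ### Dyadic grids in `[0, T]` -/

section Grid

variable {T : ℝ≥0}

/-- The points `k T / 2ⁿ` of the dyadic grid of level `n` in `[0, T]`. -/
def gridPt (T : ℝ≥0) (n k : ℕ) : Iic T :=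
  ⟨min (T * k / 2 ^ n) T, mem_Iic.2 (min_le_right _ _)⟩

theorem coe_gridPt (n k : ℕ) : (gridPt T n k : ℝ≥0) = min (T * k / 2 ^ n) T := rfl

/-- The index of the last point of the grid of level `n` that is not after `a`. -/
def gridIdx (T : ℝ≥0) (n : ℕ) (a : Iic T) : ℕ := ⌊(a : ℝ≥0) * 2 ^ n / T⌋₊

theorem monotone_gridPt (n : ℕ) : Monotone (gridPt T n) := fun i j hij =>
  Subtype.mk_le_mk.2 (min_le_min_right _ (by gcongr))

theorem monotone_gridIdx (n : ℕ) : Monotone (gridIdx T n) := fun a b hab =>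
  Nat.floor_le_floor (by
    have : (a : ℝ≥0) ≤ b := hab
    rw [div_eq_mul_inv, div_eq_mul_inv]
    gcongr)

theorem gridPt_eq_top {n k : ℕ} (h : 2 ^ n ≤ k) : gridPt T n k = ⊤ := by
  refine Subtype.ext ((coe_gridPt n k).trans (min_eq_right ?_))
  rw [le_div_iff₀ (by positivity)]
  gcongr
  exact_mod_cast h

theorem gridIdx_top (hT : 0 < T) (n : ℕ) : gridIdx T n ⊤ = 2 ^ n := by
  have : ((⊤ : Iic T) : ℝ≥0) * 2 ^ n / T = ((2 ^ n : ℕ) : ℝ≥0) := by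
    change T * 2 ^ n / T = _
    rw [mul_div_cancel_left₀ _ hT.ne']
    push_cast
    rfl
  rw [gridIdx, this, Nat.floor_natCast]

theorem gridIdx_le (hT : 0 < T) (n : ℕ) (a : Iic T) : gridIdx T n a ≤ 2 ^ n :=
  gridIdx_top hT n ▸ monotone_gridIdx n le_top

/-- Dyadic grids are nested: the point of index k at level m has index k·2^(n−m) at level n. Counts
at fine levels thus see every coarser grid point. -/
theorem gridPt_gridIdx_gridPt (hT : 0 < T) {m n : ℕ} (hmn : m ≤ n) (k : ℕ) :
    gridPt T n (gridIdx T n (gridPt T m k)) = gridPt T m k := by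
  rcases le_or_gt (2 ^ m) k with h | h
  · rw [gridPt_eq_top h, gridIdx_top hT, gridPt_eq_top le_rfl]
  · have h2 : (2 : ℝ≥0) ^ n = 2 ^ m * 2 ^ (n - m) := by rw [← pow_add]; congr 1; omega
    have h1 : ((gridPt T m k : Iic T) : ℝ≥0) = T * k / 2 ^ m := by
      refine (coe_gridPt m k).trans (min_eq_left ?_)
      rw [div_le_iff₀ (by positivity)]
      gcongr
      exact_mod_cast h.le
    have h3 : gridIdx T n (gridPt T m k) = k * 2 ^ (n - m) := by
      have : T * (k : ℝ≥0) / 2 ^ m * 2 ^ n / T = ((k * 2 ^ (n - m) : ℕ) : ℝ≥0) := by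
        rw [h2]; push_cast; field_simp
      rw [gridIdx, h1, this, Nat.floor_natCast]
    rw [h3]
    refine Subtype.ext ?_
    simp only [gridPt]
    congr 1
    rw [h2]; push_cast; field_simp

/-- The first point of the grid of level `n` after `a`. -/
def gridNext (T : ℝ≥0) (n : ℕ) (a : Iic T) : Iic T := gridPt T n (gridIdx T n a + 1)

theorem lt_gridNext (hT : 0 < T) (n : ℕ) {a : Iic T} (ha : a < ⊤) : a < gridNext T n a := by
  refine Subtype.coe_lt_coe.1 (lt_of_lt_of_eq (lt_min (c := T) ?_ ha) (coe_gridPt n _).symm)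
  rw [lt_div_iff₀ (by positivity), ← div_lt_iff₀' hT]
  rw [Nat.cast_add, Nat.cast_one]
  exact Nat.lt_floor_add_one _

theorem le_gridNext (hT : 0 < T) (n : ℕ) (a : Iic T) : a ≤ gridNext T n a := by
  rcases eq_or_ne a ⊤ with rfl | h
  · rw [gridNext, gridIdx_top hT, gridPt_eq_top (Nat.le_succ _)]
  · exact (lt_gridNext hT n (lt_top_iff_ne_top.2 h)).le

theorem gridNext_top (hT : 0 < T) (n : ℕ) : gridNext T n ⊤ = ⊤ :=
  top_le_iff.1 (le_gridNext hT n ⊤)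

theorem tendsto_gridNext (hT : 0 < T) (a : Iic T) :
    Tendsto (fun n => gridNext T n a) atTop (𝓝[≥] a) := by
  refine tendsto_nhdsWithin_iff.2 ⟨?_, Eventually.of_forall fun n => le_gridNext hT n a⟩
  rw [tendsto_subtype_rng]
  have h1 : Tendsto (fun n : ℕ => (a : ℝ≥0) + T / 2 ^ n) atTop (𝓝 a) := by
    have : Tendsto (fun n : ℕ => T * (1 / 2 : ℝ≥0) ^ n) atTop (𝓝 (T * 0)) :=
      (NNReal.tendsto_pow_atTop_nhds_zero_of_lt_one (by
        rw [← NNReal.coe_lt_coe]; push_cast; norm_num)).const_mul T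
    simpa [div_eq_mul_inv] using this.const_add (a : ℝ≥0)
  refine tendsto_of_tendsto_of_tendsto_of_le_of_le tendsto_const_nhds h1
    (fun n => le_gridNext hT n a) fun n => (coe_gridPt n _).trans_le ((min_le_left _ _).trans ?_)
  rw [div_le_iff₀ (by positivity), add_mul, div_mul_cancel₀ _ (by positivity)]
  push_cast
  rw [mul_add, mul_one, mul_comm T]
  refine add_le_add ?_ le_rfl
  have := Nat.floor_le (zero_le : 0 ≤ (a : ℝ≥0) * 2 ^ n / T)
  rwa [le_div_iff₀ hT] at this

theorem tendsto_gridNext_Ioi (hT : 0 < T) {a : Iic T} (ha : a < ⊤) :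
    Tendsto (fun n => gridNext T n a) atTop (𝓝[>] a) :=
  tendsto_nhdsWithin_iff.2 ⟨tendsto_nhds_of_tendsto_nhdsWithin (tendsto_gridNext hT a),
    Eventually.of_forall fun n => lt_gridNext hT n ha⟩

/-- Points of some dyadic grid. -/
def IsGridPt (a : Iic T) : Prop := ∃ n k, a = gridPt T n k

theorem isGridPt_gridNext (n : ℕ) (a : Iic T) : IsGridPt (gridNext T n a) := ⟨n, _, rfl⟩

end Grid

/-! ### Paths with finitely many oscillations -/

section Paths

variable {T : ℝ≥0} {G : Type*} [NormedAddCommGroup G]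

/-- If the numbers of `ε`-oscillations along the dyadic grids do not tend to infinity, then the
path oscillates by at most `2ε` on a one-sided neighbourhood of each point of `[0, T]`. -/
theorem exists_osc_le_of_liminf_greedyCount_lt_top (hT : 0 < T) (f : Iic T → G) {ε : ℝ} (hε : 0 ≤ ε)
    (h : liminf (fun n => (greedyCount ε (fun k => f (gridPt T n k)) (2 ^ n) : ℝ≥0∞)) atTop < ∞)
    (t : Iic T) :
    (t < ⊤ → ∃ d, t < d ∧ ∀ a ∈ Ioo t d, ∀ b ∈ Ioo t d, IsGridPt a → IsGridPt b →
      dist (f a) (f b) ≤ 2 * ε) ∧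
    ((∃ d, d < t) → ∃ d, d < t ∧ ∀ a ∈ Ioo d t, ∀ b ∈ Ioo d t, IsGridPt a → IsGridPt b →
      dist (f a) (f b) ≤ 2 * ε) := by
  set c : ℕ → Iic T → ℝ≥0∞ := fun n a =>
    (greedyCount ε (fun k => f (gridPt T n k)) (gridIdx T n a) : ℝ≥0∞) with hc
  -- The limiting oscillation count up to time a. It is finite and increasing, and it rises by at
  -- least 1 across two grid points whose values are more than 2ε apart. So near each point, on each
  -- side, it leaves no room for such a pair.
  set C : Iic T → ℝ≥0∞ := fun a => liminf (fun n => c n a) atTop with hC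
  have hmono : Monotone C := fun a b hab => liminf_le_liminf (Eventually.of_forall fun n => by
    simp only [hc, Nat.cast_le]
    exact monotone_greedyCount _ _ (monotone_gridIdx n hab))
  have hfin : ∀ a, C a < ∞ := fun a => by
    refine (hmono (le_top : a ≤ ⊤)).trans_lt ?_
    simpa only [hC, hc, gridIdx_top hT] using h
  have hstep : ∀ a b, a ≤ b → IsGridPt a → IsGridPt b → 2 * ε < dist (f a) (f b) →
      C a + 1 ≤ C b := by
    rintro a b hab ⟨m, k, rfl⟩ ⟨m', k', rfl⟩ hd
    rw [hC]
    simp only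
    rw [← liminf_add_const _ _ _ (by isBoundedDefault) (by isBoundedDefault)]
    refine liminf_le_liminf ?_
    filter_upwards [eventually_ge_atTop m, eventually_ge_atTop m'] with n h1 h2
    simp only [hc]
    exact_mod_cast greedyCount_add_one_le hε _ (monotone_gridIdx n hab) (by
      rw [gridPt_gridIdx_gridPt hT h1, gridPt_gridIdx_gridPt hT h2, ← dist_eq_norm, dist_comm]
      exact hd)
  have hgap : ∀ x y : Iic T, C y < C x + 1 → ∀ a ∈ Ioo x y, ∀ b ∈ Ioo x y,
      IsGridPt a → IsGridPt b → dist (f a) (f b) ≤ 2 * ε := by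
    intro x y hxy a ha b hb hga hgb
    wlog hab : a ≤ b generalizing a b
    · rw [dist_comm]; exact this b hb a ha hgb hga (le_of_not_ge hab)
    by_contra! hd
    have h1 := hstep a b hab hga hgb hd
    have h2 : C x + 1 ≤ C y :=
      (add_le_add_left (hmono ha.1.le) 1).trans (h1.trans (hmono hb.2.le))
    exact absurd h2 (not_le.2 hxy)
  constructor
  · intro ht
    have : Nonempty (Ioi t) := ⟨⟨⊤, ht⟩⟩
    -- The right limit of C at t; some d > t has C d within 1 of it, hence within 1 of C x for every
    -- x > t.
    have hL : (⨅ d : Ioi t, C d) < (⨅ d : Ioi t, C d) + 1 :=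
      ENNReal.lt_add_right ((iInf_le _ ⟨⊤, ht⟩).trans_lt (hfin ⊤)).ne one_ne_zero
    obtain ⟨d, hd⟩ := iInf_lt_iff.1 hL
    refine ⟨d, d.2, fun a ha b hb hga hgb => ?_⟩
    -- The comparison must start strictly after t, since C may jump just after t.
    obtain ⟨x, hx1, hx2⟩ := exists_between (lt_min ha.1 hb.1)
    refine hgap x d (hd.trans_le (add_le_add_left (iInf_le (fun d : Ioi t => C d) ⟨x, hx1⟩) 1))
      a ⟨hx2.trans_le (min_le_left _ _), ha.2⟩ b ⟨hx2.trans_le (min_le_right _ _), hb.2⟩ hga hgb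
  · rintro ⟨d₀, hd₀⟩
    have : Nonempty (Iio t) := ⟨⟨d₀, hd₀⟩⟩
    have hL : ∃ d : Iio t, (⨆ d : Iio t, C d) < C d + 1 := by
      by_contra! hcon
      have h1 : (⨆ d : Iio t, C d) + 1 ≤ ⨆ d : Iio t, C d := by
        rw [ENNReal.iSup_add]
        exact iSup_le hcon
      exact absurd h1 (not_le.2 (ENNReal.lt_add_right
        ((iSup_le fun d : Iio t => hmono d.2.le).trans_lt (hfin t)).ne one_ne_zero))
    obtain ⟨d, hd⟩ := hL
    refine ⟨d, d.2, fun a ha b hb hga hgb => ?_⟩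
    obtain ⟨y, hy1, hy2⟩ := exists_between (max_lt ha.2 hb.2)
    refine hgap d y ((le_iSup (fun d : Iio t => C d) ⟨y, hy2⟩).trans_lt hd)
      a ⟨ha.1, (le_max_left _ _).trans_lt hy1⟩ b ⟨hb.1, (le_max_right _ _).trans_lt hy1⟩ hga hgb

/-- The right limit along the dyadic points. -/
def gridLim (f : Iic T → G) (t : Iic T) : G := limUnder atTop fun n => f (gridNext T n t)

/-- The path has small oscillation, along the dyadic points, near each point and on each side. -/
def HasGridLimits (f : Iic T → G) : Prop :=
  ∀ t : Iic T, ∀ ε > 0,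
    (t < ⊤ → ∃ d, t < d ∧ ∀ a ∈ Ioo t d, ∀ b ∈ Ioo t d, IsGridPt a → IsGridPt b →
      dist (f a) (f b) ≤ ε) ∧
    ((∃ d, d < t) → ∃ d, d < t ∧ ∀ a ∈ Ioo d t, ∀ b ∈ Ioo d t, IsGridPt a → IsGridPt b →
      dist (f a) (f b) ≤ ε)

variable [CompleteSpace G] {f : Iic T → G}

/-- For t < T the sequence decreases its distance to t from the right, where small oscillation makes
the values Cauchy; at the final time it is constant, so the limit there is f ⊤ itself. -/
theorem HasGridLimits.tendsto_gridLim (hT : 0 < T) (hf : HasGridLimits f) (t : Iic T) :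
    Tendsto (fun n => f (gridNext T n t)) atTop (𝓝 (gridLim f t)) := by
  refine CauchySeq.tendsto_limUnder ?_
  rcases eq_or_ne t ⊤ with rfl | ht
  · simp_rw [gridNext_top hT]
    exact (tendsto_const_nhds (x := f ⊤)).cauchySeq
  · have ht := lt_top_iff_ne_top.2 ht
    refine Metric.cauchySeq_iff'.2 fun ε hε => ?_
    obtain ⟨d, hd, h⟩ := (hf t (ε / 2) (half_pos hε)).1 ht
    have h1 := (tendsto_gridNext_Ioi hT ht).eventually (Ioo_mem_nhdsGT hd)
    obtain ⟨N, hN⟩ := eventually_atTop.1 h1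
    exact ⟨N, fun n hn => (h _ (hN n hn) _ (hN N le_rfl) (isGridPt_gridNext _ _)
      (isGridPt_gridNext _ _)).trans_lt (half_lt_self hε)⟩

theorem HasGridLimits.dist_gridLim_le (hT : 0 < T) (hf : HasGridLimits f) {x y : Iic T} {ε : ℝ}
    (h : ∀ a ∈ Ioo x y, ∀ b ∈ Ioo x y, IsGridPt a → IsGridPt b → dist (f a) (f b) ≤ ε)
    {s t : Iic T} (hs : s ∈ Ioo x y) (ht : t ∈ Ioo x y) :
    dist (gridLim f s) (gridLim f t) ≤ ε := by
  have hev : ∀ u ∈ Ioo x y, ∀ᶠ n in atTop, gridNext T n u ∈ Ioo x y := fun u hu =>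
    (tendsto_nhds_of_tendsto_nhdsWithin (tendsto_gridNext hT u)).eventually
      (Ioo_mem_nhds hu.1 hu.2)
  refine le_of_tendsto ((hf.tendsto_gridLim hT s).dist (hf.tendsto_gridLim hT t)) ?_
  filter_upwards [hev s hs, hev t ht] with n h1 h2
  exact h _ h1 _ h2 (isGridPt_gridNext _ _) (isGridPt_gridNext _ _)

/-- Every value of `gridLim` is a limit of values at nearby grid points, so the oscillation bounds
pass from grid points to all points. They give right continuity, and a Cauchy filter on the left. -/
theorem HasGridLimits.isCadlag_gridLim (hT : 0 < T) (hf : HasGridLimits f) :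
    IsCadlag (gridLim f) := by
  intro t
  constructor
  · rw [← continuousWithinAt_Ioi_iff_Ici]
    refine Metric.tendsto_nhds.2 fun ε hε => ?_
    rcases eq_or_ne t ⊤ with rfl | ht
    · simp
    have ht := lt_top_iff_ne_top.2 ht
    obtain ⟨d, hd, h⟩ := (hf t (ε / 2) (half_pos hε)).1 ht
    filter_upwards [Ioo_mem_nhdsGT hd] with s hs
    refine lt_of_le_of_lt (le_of_tendsto (tendsto_const_nhds.dist (hf.tendsto_gridLim hT t)) ?_)
      (half_lt_self hε)
    filter_upwards [(tendsto_gridNext_Ioi hT ht).eventually (Ioo_mem_nhdsGT hd)] with n hn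
    refine le_of_tendsto ((hf.tendsto_gridLim hT s).dist tendsto_const_nhds) ?_
    filter_upwards [(tendsto_nhds_of_tendsto_nhdsWithin (tendsto_gridNext hT s)).eventually
      (Ioo_mem_nhds hs.1 hs.2)] with m hm
    exact h _ hm _ hn (isGridPt_gridNext _ _) (isGridPt_gridNext _ _)
  · by_cases hb : ∃ d, d < t
    · obtain ⟨d₀, hd₀⟩ := hb
      have : (𝓝[<] t).NeBot := nhdsLT_neBot_of_exists_lt ⟨d₀, hd₀⟩
      refine cauchy_map_iff_exists_tendsto.1 (Metric.cauchy_iff.2 ⟨inferInstance, fun ε hε => ?_⟩)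
      obtain ⟨d, hd, h⟩ := (hf t (ε / 2) (half_pos hε)).2 ⟨d₀, hd₀⟩
      refine ⟨_, image_mem_map (Ioo_mem_nhdsLT hd), ?_⟩
      rintro _ ⟨u, hu, rfl⟩ _ ⟨v, hv, rfl⟩
      exact (hf.dist_gridLim_le hT h hu hv).trans_lt (half_lt_self hε)
    · have : Iio t = ∅ := by
        ext d; simp only [mem_Iio, mem_empty_iff_false, iff_false]; exact fun h => hb ⟨d, h⟩
      -- At the initial time the left neighbourhood filter is trivial and any value is a left limit.
      exact ⟨0, by simp [this]⟩

end Paths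

/-! ### Càdlàg modifications and the maximal inequality -/

section Modification

variable {Ω : Type*} {mΩ : MeasurableSpace Ω} {P : Measure Ω}
  {G : Type*} [NormedAddCommGroup G]

/-- If the σ-algebra `m` contains all null sets, measurability with respect to `m` is stable under
modifications on null sets. -/
theorem MeasureTheory.StronglyMeasurable.congr_of_null_mem [SecondCountableTopology G]
    {m : MeasurableSpace Ω} (hm : ∀ N : Set Ω, P N = 0 → MeasurableSet[m] N) {f g : Ω → G}
    (hf : StronglyMeasurable[m] f) (hfg : f =ᵐ[P] g) : StronglyMeasurable[m] g := by
  borelize G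
  rw [stronglyMeasurable_iff_measurable] at hf ⊢
  have hN : P {ω | f ω ≠ g ω} = 0 := hfg
  intro S hS
  have : g ⁻¹' S = (f ⁻¹' S \ {ω | f ω ≠ g ω}) ∪ (g ⁻¹' S ∩ {ω | f ω ≠ g ω}) := by
    ext ω
    by_cases h : f ω = g ω <;> simp [h]
  rw [this]
  exact ((hf hS).diff (hm _ hN)).union (hm _ (measure_mono_null inter_subset_right hN))

/-- Two right continuous processes that are modifications of each other are indistinguishable. -/
theorem ae_forall_eq_of_forall_ae_eq {T : ℝ≥0} (hT : 0 < T) {X Y : Iic T → Ω → G}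
    (hX : ∀ ω t, ContinuousWithinAt (fun s => X s ω) (Ici t) t)
    (hY : ∀ ω t, ContinuousWithinAt (fun s => Y s ω) (Ici t) t)
    (h : ∀ t, X t =ᵐ[P] Y t) : ∀ᵐ ω ∂P, ∀ t, X t ω = Y t ω := by
  have h1 : ∀ᵐ ω ∂P, ∀ n k, X (gridPt T n k) ω = Y (gridPt T n k) ω :=
    ae_all_iff.2 fun n => ae_all_iff.2 fun k => h _
  filter_upwards [h1] with ω hω t
  refine tendsto_nhds_unique ((hX ω t).tendsto.comp (tendsto_gridNext hT t)) ?_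
  refine ((hY ω t).tendsto.comp (tendsto_gridNext hT t)).congr fun n => ?_
  exact (hω _ _).symm

variable [InnerProductSpace ℝ G]

/-- The filtration along an increasing sequence of times. -/
def sampledFiltration {ι : Type*} [Preorder ι] (ℱ : Filtration ι mΩ) {u : ℕ → ι}
    (hu : Monotone u) : Filtration ℕ mΩ where
  seq k := ℱ (u k)
  mono' _ _ h := ℱ.mono (hu h)
  le' k := ℱ.le (u k)

theorem MeasureTheory.Martingale.sampled {ι : Type*} [Preorder ι] {ℱ : Filtration ι mΩ}
    {X : ι → Ω → G} (hX : Martingale X ℱ P) {u : ℕ → ι} (hu : Monotone u) :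
    Martingale (fun k => X (u k)) (sampledFiltration ℱ hu) P :=
  ⟨fun k => hX.1 (u k), fun _ _ h => hX.2 _ _ (hu h)⟩

variable [CompleteSpace G] [IsFiniteMeasure P] {T : ℝ≥0} {ℱ : Filtration (Iic T) mΩ}
  {X : Iic T → Ω → G}

/-- The expected oscillation counts are bounded uniformly in the grid level, so by Fatou their
liminf is almost surely finite, simultaneously for all ε = 1/(m+1). -/
theorem ae_hasGridLimits (hT : 0 < T) (hX : Martingale X ℱ P) (hX2 : ∀ t, MemLp (X t) 2 P) :
    ∀ᵐ ω ∂P, HasGridLimits fun t => X t ω := by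
  have h1 : ∀ m : ℕ, ∀ᵐ ω ∂P, liminf (fun n => (greedyCount (1 / ((m : ℝ) + 1))
      (fun k => X (gridPt T n k) ω) (2 ^ n) : ℝ≥0∞)) atTop < ∞ := by
    intro m
    set ε : ℝ := 1 / ((m : ℝ) + 1) with hε
    have hε0 : 0 < ε := by positivity
    have hmeas : ∀ n : ℕ, Measurable fun ω =>
        (greedyCount ε (fun k => X (gridPt T n k) ω) (2 ^ n) : ℝ≥0∞) := fun n =>
      measurable_from_nat.comp
        (measurable_greedyCount (hX.sampled (monotone_gridPt n)) ε (2 ^ n))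
    refine ae_lt_top (Measurable.liminf hmeas) (ne_top_of_le_ne_top ?_ (lintegral_liminf_le hmeas))
    have hb : ∀ n : ℕ, ∫⁻ ω, (greedyCount ε (fun k => X (gridPt T n k) ω) (2 ^ n) : ℝ≥0∞) ∂P
        ≤ (∫⁻ ω, ‖X ⊤ ω‖ₑ ^ 2 ∂P) / ENNReal.ofReal (ε ^ 2) := fun n => by
      rw [ENNReal.le_div_iff_mul_le (Or.inl (by simpa using hε0.ne')) (Or.inl (by simp)), mul_comm]
      have := lintegral_greedyCount_le (hX.sampled (monotone_gridPt n)) (fun k => hX2 _) hε0.le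
        (2 ^ n)
      rwa [gridPt_eq_top le_rfl] at this
    refine ne_top_of_le_ne_top ?_ ((liminf_le_liminf (Eventually.of_forall hb)).trans
      (liminf_const _).le)
    refine ENNReal.div_ne_top ?_ (by simpa using hε0.ne')
    rw [(hX2 ⊤).lintegral_enorm_sq]
    simp
  filter_upwards [ae_all_iff.2 h1] with ω hω t ε hε
  obtain ⟨m, hm⟩ := exists_nat_one_div_lt (half_pos hε)
  have := exists_osc_le_of_liminf_greedyCount_lt_top hT (fun t => X t ω)
    (by positivity : 0 ≤ 1 / ((m : ℝ) + 1)) (hω m) t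
  refine ⟨fun h => ?_, fun h => ?_⟩
  · obtain ⟨d, hd, h⟩ := this.1 h
    exact ⟨d, hd, fun a ha b hb hga hgb => (h a ha b hb hga hgb).trans (by linarith)⟩
  · obtain ⟨d, hd, h⟩ := this.2 h
    exact ⟨d, hd, fun a ha b hb hga hgb => (h a ha b hb hga hgb).trans (by linarith)⟩

/-- A square integrable martingale that is right continuous in probability has a càdlàg
modification, if the filtration contains the null sets. -/
theorem exists_cadlag_modification [TopologicalSpace.SeparableSpace G] (hT : 0 < T)
    (hnull : ∀ t, ∀ N : Set Ω, P N = 0 → MeasurableSet[ℱ t] N)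
    (hX : Martingale X ℱ P) (hX2 : ∀ t, MemLp (X t) 2 P)
    (hrc : ∀ t, TendstoInMeasure P X (𝓝[>] t) (X t)) :
    ∃ Y : Iic T → Ω → G, Martingale Y ℱ P ∧ (∀ t, MemLp (Y t) 2 P) ∧
      (∀ ω, IsCadlag fun t => Y t ω) ∧ ∀ t, Y t =ᵐ[P] X t := by
  classical
  have := UniformSpace.secondCountable_of_separable G
  have hgood := ae_hasGridLimits hT hX hX2
  -- No measurability of the good event is needed: Y t will be adapted because it agrees almost
  -- everywhere with X t and the null sets lie in every σ-algebra.
  set Y : Iic T → Ω → G := fun t ω =>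
    if HasGridLimits (fun t => X t ω) then gridLim (fun t => X t ω) t else 0 with hY
  have hYX : ∀ t, Y t =ᵐ[P] X t := by
    intro t
    have hlim : ∀ᵐ ω ∂P, Tendsto (fun n => X (gridNext T n t) ω) atTop (𝓝 (Y t ω)) := by
      filter_upwards [hgood] with ω hω
      simp only [hY, if_pos hω]
      exact hω.tendsto_gridLim hT t
    rcases eq_or_ne t ⊤ with rfl | ht
    · filter_upwards [hlim] with ω hω
      simp_rw [gridNext_top hT] at hω
      exact (tendsto_nhds_unique tendsto_const_nhds hω).symm
    -- Along the grid points to the right of t, X converges almost surely to Y t and in probability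
    -- to X t.
    · exact tendstoInMeasure_ae_unique (tendstoInMeasure_of_tendsto_ae
        (fun n => (hX2 _).1) hlim)
        ((hrc t).comp (tendsto_gridNext_Ioi hT (lt_top_iff_ne_top.2 ht)))
  refine ⟨Y, hX.congr (fun t => ?_) fun t => (hYX t).symm,
    fun t => (memLp_congr_ae (hYX t)).2 (hX2 t),
    fun ω => ?_, hYX⟩
  · exact (hX.stronglyMeasurable t).congr_of_null_mem (hnull t) (hYX t).symm
  · by_cases h : HasGridLimits fun t => X t ω
    · simp only [hY, if_pos h]
      exact h.isCadlag_gridLim hT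
    · simp only [hY, if_neg h]
      exact fun t => ⟨continuousWithinAt_const, 0, tendsto_const_nhds⟩

/-- Doob's `L²` maximal inequality for right continuous martingales on `[0, T]`. -/
theorem lintegral_iSup_enorm_sq_le (hT : 0 < T) (hX : Martingale X ℱ P)
    (hX2 : ∀ t, MemLp (X t) 2 P) (hrc : ∀ ω t, ContinuousWithinAt (fun s => X s ω) (Ici t) t) :
    ∫⁻ ω, ⨆ t, ‖X t ω‖ₑ ^ 2 ∂P ≤ 4 * ∫⁻ ω, ‖X ⊤ ω‖ₑ ^ 2 ∂P := by
  -- `gridNext` at the final time has index 2 ^ n + 1, so the maximum runs one step beyond the last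
  -- grid point; the grid is constant equal to ⊤ there.
  set S : ℕ → Ω → ℝ≥0∞ := fun n ω =>
    ‖runMax (fun k => X (gridPt T n k) ω) (2 ^ n + 1)‖ₑ ^ 2 with hS
  have hSm : ∀ n, Measurable (S n) := fun n =>
    (((stronglyMeasurable_runMax (hX.sampled (monotone_gridPt n)) (2 ^ n + 1)).mono
      (Filtration.le _ _)).enorm).pow_const 2
  have hle : ∀ ω, ⨆ t, ‖X t ω‖ₑ ^ 2 ≤ liminf (fun n => S n ω) atTop := by
    refine fun ω => iSup_le fun t => ?_
    have hlim : Tendsto (fun n => ‖X (gridNext T n t) ω‖ₑ ^ 2) atTop (𝓝 (‖X t ω‖ₑ ^ 2)) :=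
      ENNReal.Tendsto.pow (((hrc ω t).tendsto.comp (tendsto_gridNext hT t)).enorm)
    rw [← hlim.liminf_eq]
    refine liminf_le_liminf (Eventually.of_forall fun n => ?_)
    simp only [hS]
    gcongr
    rw [Real.enorm_of_nonneg (runMax_nonneg _ _), ← ofReal_norm]
    exact ENNReal.ofReal_le_ofReal (norm_le_runMax (fun k => X (gridPt T n k) ω)
      (Nat.add_le_add_right (gridIdx_le hT n t) 1))
  refine (lintegral_mono hle).trans ((lintegral_liminf_le hSm).trans ?_)
  refine (liminf_le_liminf (Eventually.of_forall fun n => ?_)).trans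
    (liminf_const (f := atTop (α := ℕ)) _).le
  have := lintegral_runMax_sq_le (hX.sampled (monotone_gridPt n)) (fun k => hX2 _) (2 ^ n + 1)
  rwa [gridPt_eq_top (Nat.le_succ _)] at this

end Modification

/-! ### The covariance of a cylindrical martingale-valued measure -/

theorem HilbertianSeminorm.val_sq {H : Type*} [NormedAddCommGroup H] [InnerProductSpace ℝ H]
    (q : HilbertianSeminorm H) (h : H) : q.val h ^ 2 = q.form h h :=
  Real.sq_sqrt (q.nonneg h)

theorem HilbertianSeminorm.form_sum {H κ : Type*} [NormedAddCommGroup H] [InnerProductSpace ℝ H]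
    (q : HilbertianSeminorm H) (E : Finset κ) (c : κ → ℝ) (h : κ → H) :
    q.form (∑ k ∈ E, c k • h k) (∑ k ∈ E, c k • h k)
      = ∑ k ∈ E, ∑ l ∈ E, c k * c l * q.form (h k) (h l) := by
  simp only [map_sum, LinearMap.sum_apply, map_smul, LinearMap.smul_apply, smul_eq_mul]
  rw [Finset.sum_comm]
  refine Finset.sum_congr rfl fun k _ => ?_
  rw [Finset.mul_sum]
  exact Finset.sum_congr rfl fun l _ => by ring

namespace CylMartingaleMeasure

variable {Ω : Type*} {mΩ : MeasurableSpace Ω} {P : Measure Ω} {ℱ : Filtration ℝ≥0 mΩ}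
  {H : Type*} [NormedAddCommGroup H] [InnerProductSpace ℝ H]
  {U : Type*} [TopologicalSpace U] [MeasurableSpace U]
  (M : CylMartingaleMeasure P ℱ H U)

instance : SigmaFinite M.μ := M.sigmaFinite_μ

instance : SigmaFinite M.lam :=
  ⟨⟨⟨fun n : ℕ => Iic (n : ℝ≥0), fun _ => trivial, fun n => M.lam_lt_top n, by
    refine eq_univ_of_forall fun x => mem_iUnion.2 ?_
    obtain ⟨n, hn⟩ := exists_nat_ge x
    exact ⟨n, hn⟩⟩⟩⟩

/-- The product measure `λ ⊗ μ` on time and space. -/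
abbrev timeSpace : Measure (ℝ≥0 × U) := M.lam.prod M.μ

/-- The bilinear forms on bounded time intervals are uniformly bounded. -/
theorem exists_form_le [CompleteSpace H] (T : ℝ≥0) :
    ∃ C : ℝ, 0 ≤ C ∧ ∀ r ≤ T, ∀ u h, (M.q r u).form h h ≤ C * ‖h‖ ^ 2 := by
  set p : Iic T × U → Seminorm ℝ H := fun i =>
    (normSeminorm ℝ (M.q i.1 i.2).Space).comp (M.q i.1 i.2).incl.toLinearMap with hp
  have hpv : ∀ i h, p i h = (M.q i.1 i.2).val h := fun i h => (M.q i.1 i.2).norm_incl h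
  have hbdd : BddAbove (range p) := by
    rw [Seminorm.bddAbove_range_iff]
    intro h
    obtain ⟨C, hC⟩ := M.bounded_q T h h
    refine ⟨√C, ?_⟩
    rintro _ ⟨i, rfl⟩
    change p i h ≤ _
    rw [hpv]
    exact Real.sqrt_le_sqrt ((le_abs_self _).trans (hC _ i.1.2 _))
  -- Banach–Steinhaus: H is complete, so a pointwise bounded supremum of continuous seminorms is
  -- continuous, and therefore dominated by a multiple of the norm.
  have hcont : Continuous (⨆ i, p i : Seminorm ℝ H) :=
    Seminorm.coe_iSup_eq hbdd ▸
      Seminorm.continuous_iSup p (fun i => (M.q i.1 i.2).incl.continuous.norm) hbdd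
  obtain ⟨C, hC, hle⟩ := Seminorm.bound_of_continuous_normedSpace _ hcont
  refine ⟨C ^ 2, by positivity, fun r hr u h => ?_⟩
  have h1 : (M.q r u).val h ≤ C * ‖h‖ := by
    refine le_trans ?_ (hle h)
    have := le_ciSup hbdd (⟨r, hr⟩, u) h
    rwa [hpv] at this
  rw [← HilbertianSeminorm.val_sq, ← mul_pow]
  exact pow_le_pow_left₀ (Real.sqrt_nonneg _) h1 2

variable {A B : Set U}

theorem measurableSet_of_mem_ring [BorelSpace U] (hA : A ∈ M.ring) : MeasurableSet A := by
  have : MeasurableSet[MeasurableSpace.generateFrom M.ring] A :=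
    MeasurableSpace.measurableSet_generateFrom hA
  rwa [M.generateFrom_ring, ← BorelSpace.measurable_eq (α := U)] at this

theorem timeSpace_lt_top (hA : A ∈ M.ring) (T : ℝ≥0) : M.timeSpace (Iic T ×ˢ A) < ∞ := by
  rw [Measure.prod_prod]
  exact ENNReal.mul_lt_top (M.lam_lt_top T) (M.μ_lt_top A hA)

theorem integrableOn_form [BorelSpace U] (hA : A ∈ M.ring) {D : Set (ℝ≥0 × U)} {T : ℝ≥0}
    (hD : D ⊆ Iic T ×ˢ A) (h₁ h₂ : H) :
    IntegrableOn (fun p => (M.q p.1 p.2).form h₁ h₂) D M.timeSpace := by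
  obtain ⟨C, hC⟩ := M.bounded_q T h₁ h₂
  refine IntegrableOn.mono_set ?_ hD
  refine Measure.integrableOn_of_bounded (M := C) (M.timeSpace_lt_top hA T).ne
    (M.measurable_q h₁ h₂).aestronglyMeasurable ?_
  refine (ae_restrict_iff' (measurableSet_Iic.prod (M.measurableSet_of_mem_ring hA))).2
    (ae_of_all _ fun p hp => hC _ hp.1 _)

theorem lintegral_form [BorelSpace U] (hA : A ∈ M.ring) (s t : ℝ≥0) (h : H) :
    ∫⁻ r in Ioc s t, ∫⁻ u in A, ENNReal.ofReal ((M.q r u).val h ^ 2) ∂M.μ ∂M.lam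
      = ENNReal.ofReal (∫ p in Ioc s t ×ˢ A, (M.q p.1 p.2).form h h ∂M.timeSpace) := by
  simp_rw [HilbertianSeminorm.val_sq]
  have hD : Ioc s t ×ˢ A ⊆ Iic t ×ˢ A := prod_mono Ioc_subset_Iic_self le_rfl
  rw [ofReal_integral_eq_lintegral_ofReal (M.integrableOn_form hA hD h h)
    (ae_of_all _ fun p => (M.q p.1 p.2).nonneg h), ← Measure.prod_restrict, lintegral_prod]
  exact (M.measurable_q h h).ennreal_ofReal.aemeasurable

theorem coeFn_incr (s t : ℝ≥0) (A : Set U) (h : H) :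
    M.incr s t A h =ᵐ[P] fun ω => M.M t A h ω - M.M s A h ω :=
  AEEqFun.coeFn_sub _ _

theorem incr_self (s : ℝ≥0) (A : Set U) : M.incr s s A = 0 := sub_self _

theorem incr_add_incr (s r t : ℝ≥0) (A : Set U) (h : H) :
    M.incr s t A h =ᵐ[P] M.incr s r A h + M.incr r t A h := by
  have : M.incr s t A h = M.incr s r A h + M.incr r t A h := by
    rw [← LinearMap.add_apply]; congr 1; simp [incr]
  rw [this]
  exact AEEqFun.coeFn_add _ _

theorem incr_map_add (s t : ℝ≥0) (A : Set U) (h₁ h₂ : H) :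
    M.incr s t A (h₁ + h₂) =ᵐ[P] M.incr s t A h₁ + M.incr s t A h₂ := by
  rw [map_add]
  exact AEEqFun.coeFn_add _ _

theorem incr_union (hA : A ∈ M.ring) (hB : B ∈ M.ring) (hAB : Disjoint A B) (s t : ℝ≥0) (h : H) :
    M.incr s t (A ∪ B) h =ᵐ[P] M.incr s t A h + M.incr s t B h := by
  have : M.incr s t (A ∪ B) h = M.incr s t A h + M.incr s t B h := by
    simp only [incr, LinearMap.sub_apply, M.union t A hA B hB hAB h, M.union s A hA B hB hAB h]
    abel
  rw [this]
  exact AEEqFun.coeFn_add _ _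

theorem memLp_incr (hA : A ∈ M.ring) (s t : ℝ≥0) (h : H) : MemLp (M.incr s t A h) 2 P :=
  (memLp_congr_ae (M.coeFn_incr s t A h)).2 ((M.memLp A hA t h).sub (M.memLp A hA s h))

/-- The representative of the class M t A − M s A equals the difference of the representatives only
almost everywhere; since the filtration contains the null sets, it is still measurable at time t. -/
theorem stronglyMeasurable_incr (hℱ : UsualConditions P ℱ) (hA : A ∈ M.ring) {s t : ℝ≥0}
    (hst : s ≤ t) (h : H) : StronglyMeasurable[ℱ t] (M.incr s t A h) := by
  refine StronglyMeasurable.congr_of_null_mem (P := P)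
    (fun N hN => ℱ.mono zero_le _ (hℱ.null_mem N hN)) ?_ (M.coeFn_incr s t A h).symm
  exact ((M.martingale A hA h).stronglyMeasurable t).sub
    (((M.martingale A hA h).stronglyMeasurable s).mono (ℱ.mono hst))

theorem integral_mul_incr_eq_zero [IsFiniteMeasure P] (hA : A ∈ M.ring) {s t : ℝ≥0} (hst : s ≤ t)
    (h : H) {V : Ω → ℝ} (hV : StronglyMeasurable[ℱ s] V) (hV2 : MemLp V 2 P) :
    ∫ ω, V ω * M.incr s t A h ω ∂P = 0 := by
  have := (M.martingale A hA h).integral_inner_increment_eq_zero (fun t => M.memLp A hA t h) hst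
    hV hV2
  rw [← this]
  refine integral_congr_ae ?_
  filter_upwards [M.coeFn_incr s t A h] with ω hω
  rw [hω, real_inner_eq_re_inner]
  simp [mul_comm]

theorem integral_incr_mul_incr_of_disjoint (hA : A ∈ M.ring) (hB : B ∈ M.ring)
    (hAB : Disjoint A B) (s t : ℝ≥0) (h₁ h₂ : H) :
    ∫ ω, M.incr s t A h₁ ω * M.incr s t B h₂ ω ∂P = 0 := by
  have hint : ∀ r r', Integrable (fun ω => M.M r A h₁ ω * M.M r' B h₂ ω) P := fun r r' =>
    (M.memLp A hA r h₁).integrable_mul (M.memLp B hB r' h₂)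
  have : ∀ᵐ ω ∂P, M.incr s t A h₁ ω * M.incr s t B h₂ ω
      = (M.M t A h₁ ω * M.M t B h₂ ω - M.M t A h₁ ω * M.M s B h₂ ω)
        - (M.M s A h₁ ω * M.M t B h₂ ω - M.M s A h₁ ω * M.M s B h₂ ω) := by
    filter_upwards [M.coeFn_incr s t A h₁, M.coeFn_incr s t B h₂] with ω h1 h2
    rw [h1, h2]; ring
  have hint2 : ∀ r, Integrable (fun ω => M.M r A h₁ ω * M.M t B h₂ ω
      - M.M r A h₁ ω * M.M s B h₂ ω) P := fun r => (hint _ _).sub (hint _ _)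
  rw [integral_congr_ae this, integral_sub (hint2 _) (hint2 _), integral_sub (hint _ _) (hint _ _),
    integral_sub (hint _ _) (hint _ _)]
  simp [M.orthogonal A hA B hB hAB]

variable [BorelSpace U]

theorem integral_incr_sq (hA : A ∈ M.ring) {s t : ℝ≥0} (hst : s ≤ t) (h : H) :
    ∫ ω, M.incr s t A h ω ^ 2 ∂P
      = ∫ p in Ioc s t ×ˢ A, (M.q p.1 p.2).form h h ∂M.timeSpace := by
  rcases hst.eq_or_lt with rfl | hst
  · rw [incr_self, LinearMap.zero_apply]
    have : (fun ω => (0 : Ω →ₘ[P] ℝ) ω ^ 2) =ᵐ[P] fun _ => 0 := by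
      filter_upwards [AEEqFun.coeFn_zero (μ := P) (β := ℝ)] with ω hω
      rw [hω]; simp
    rw [integral_congr_ae this]
    simp
  have h1 := M.covariance A hA s t hst h
  rw [M.lintegral_form hA] at h1
  have h2 := (M.memLp_incr hA s t h).lintegral_enorm_sq
  rw [incr, h1] at h2
  rw [(ENNReal.ofReal_eq_ofReal_iff ?_ ?_).1 h2]
  · simp [incr]
  · exact integral_nonneg fun p => (M.q p.1 p.2).nonneg h
  · exact integral_nonneg fun _ => by positivity

/-- Polarization of `integral_incr_sq`. -/
theorem integral_incr_mul_incr_same (hA : A ∈ M.ring) {s t : ℝ≥0} (hst : s ≤ t) (h₁ h₂ : H) :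
    ∫ ω, M.incr s t A h₁ ω * M.incr s t A h₂ ω ∂P
      = ∫ p in Ioc s t ×ˢ A, (M.q p.1 p.2).form h₁ h₂ ∂M.timeSpace := by
  have hI : ∀ a b, Integrable (fun ω => M.incr s t A a ω * M.incr s t A b ω) P := fun a b =>
    (M.memLp_incr hA s t a).integrable_mul (M.memLp_incr hA s t b)
  have hI2 : ∀ a, Integrable (fun ω => M.incr s t A a ω ^ 2) P := fun a =>
    (M.memLp_incr hA s t a).integrable_sq
  have hJ : ∀ a b, Integrable (fun p => (M.q p.1 p.2).form a b)
      (M.timeSpace.restrict (Ioc s t ×ˢ A)) := fun a b =>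
    M.integrableOn_form hA (T := t) (prod_mono Ioc_subset_Iic_self le_rfl) a b
  have h := M.integral_incr_sq hA hst (h₁ + h₂)
  have e1 : ∀ᵐ ω ∂P, M.incr s t A (h₁ + h₂) ω ^ 2 = (M.incr s t A h₁ ω ^ 2
      + M.incr s t A h₂ ω ^ 2) + 2 * (M.incr s t A h₁ ω * M.incr s t A h₂ ω) := by
    filter_upwards [M.incr_map_add s t A h₁ h₂] with ω hω
    rw [hω, Pi.add_apply]; ring
  have e2 : ∀ p : ℝ≥0 × U, (M.q p.1 p.2).form (h₁ + h₂) (h₁ + h₂)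
      = ((M.q p.1 p.2).form h₁ h₁ + (M.q p.1 p.2).form h₂ h₂)
        + 2 * (M.q p.1 p.2).form h₁ h₂ := fun p => by
    simp only [map_add, LinearMap.add_apply, (M.q p.1 p.2).symm h₂ h₁]; ring
  have hI3 : Integrable (fun ω => M.incr s t A h₁ ω ^ 2 + M.incr s t A h₂ ω ^ 2) P :=
    (hI2 _).add (hI2 _)
  have hJ3 : Integrable (fun p => (M.q p.1 p.2).form h₁ h₁ + (M.q p.1 p.2).form h₂ h₂)
      (M.timeSpace.restrict (Ioc s t ×ˢ A)) := (hJ _ _).add (hJ _ _)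
  rw [integral_congr_ae e1, integral_congr_ae (ae_of_all _ e2),
    integral_add hI3 ((hI _ _).const_mul 2), integral_add (hI2 _) (hI2 _),
    integral_add hJ3 ((hJ _ _).const_mul 2), integral_add (hJ _ _) (hJ _ _),
    M.integral_incr_sq hA hst, M.integral_incr_sq hA hst, integral_const_mul,
    integral_const_mul] at h
  linarith

/-- Splitting A and B along A ∩ B, A \ B and B \ A, every product over disjoint sets has mean zero
and only the common part contributes. -/
theorem integral_incr_mul_incr_interval (hA : A ∈ M.ring) (hB : B ∈ M.ring) {s t : ℝ≥0}
    (hst : s ≤ t) (h₁ h₂ : H) :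
    ∫ ω, M.incr s t A h₁ ω * M.incr s t B h₂ ω ∂P
      = ∫ p in Ioc s t ×ˢ (A ∩ B), (M.q p.1 p.2).form h₁ h₂ ∂M.timeSpace := by
  have hAB : A ∩ B ∈ M.ring := M.isSetRing.inter_mem hA hB
  have hA' : A \ B ∈ M.ring := M.isSetRing.sdiff_mem hA hB
  have hB' : B \ A ∈ M.ring := M.isSetRing.sdiff_mem hB hA
  have hI : ∀ {C D : Set U}, C ∈ M.ring → D ∈ M.ring →
      Integrable (fun ω => M.incr s t C h₁ ω * M.incr s t D h₂ ω) P := fun hC hD =>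
    (M.memLp_incr hC s t h₁).integrable_mul (M.memLp_incr hD s t h₂)
  have d1 : Disjoint (A ∩ B) (A \ B) := disjoint_sdiff_inter.symm
  have d2 : Disjoint (A ∩ B) (B \ A) := by rw [inter_comm]; exact disjoint_sdiff_inter.symm
  have d3 : Disjoint (A \ B) (B \ A) := disjoint_sdiff_sdiff
  have e1 := M.incr_union hAB hA' d1 s t h₁
  have e2 := M.incr_union hAB hB' d2 s t h₂
  rw [inter_union_sdiff] at e1
  rw [inter_comm, inter_union_sdiff, inter_comm] at e2
  have e : ∀ᵐ ω ∂P, M.incr s t A h₁ ω * M.incr s t B h₂ ω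
      = (M.incr s t (A ∩ B) h₁ ω * M.incr s t (A ∩ B) h₂ ω
        + M.incr s t (A ∩ B) h₁ ω * M.incr s t (B \ A) h₂ ω)
        + (M.incr s t (A \ B) h₁ ω * M.incr s t (A ∩ B) h₂ ω
        + M.incr s t (A \ B) h₁ ω * M.incr s t (B \ A) h₂ ω) := by
    filter_upwards [e1, e2] with ω h1 h2
    rw [h1, h2, Pi.add_apply, Pi.add_apply]; ring
  have hI2 : ∀ {C : Set U}, C ∈ M.ring →
      Integrable (fun ω => M.incr s t C h₁ ω * M.incr s t (A ∩ B) h₂ ω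
        + M.incr s t C h₁ ω * M.incr s t (B \ A) h₂ ω) P := fun hC => (hI hC hAB).add (hI hC hB')
  rw [integral_congr_ae e, integral_add (hI2 hAB) (hI2 hA'), integral_add (hI hAB hAB) (hI hAB hB'),
    integral_add (hI hA' hAB) (hI hA' hB'), M.integral_incr_mul_incr_of_disjoint hAB hB' d2,
    M.integral_incr_mul_incr_of_disjoint hA' hAB d1.symm,
    M.integral_incr_mul_incr_of_disjoint hA' hB' d3, M.integral_incr_mul_incr_same hAB hst]
  simp

/-- The pair of increments is independent of ℱ s, so the product of the two is independent of F and
the probability of F factors out. -/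
theorem setIntegral_incr_mul_incr (hA : A ∈ M.ring) (hB : B ∈ M.ring) {s t : ℝ≥0}
    (hst : s ≤ t) (h₁ h₂ : H) {F : Set Ω} (hF : MeasurableSet[ℱ s] F) :
    ∫ ω in F, M.incr s t A h₁ ω * M.incr s t B h₂ ω ∂P
      = P.real F * ∫ p in Ioc s t ×ˢ (A ∩ B), (M.q p.1 p.2).form h₁ h₂ ∂M.timeSpace := by
  rcases hst.eq_or_lt with rfl | hlt
  · have : ∀ᵐ ω ∂P.restrict F, M.incr s s A h₁ ω * M.incr s s B h₂ ω = 0 := by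
      refine ae_restrict_of_ae ?_
      rw [incr_self, LinearMap.zero_apply]
      filter_upwards [AEEqFun.coeFn_zero (μ := P) (β := ℝ)] with ω hω
      rw [hω]; simp
    rw [integral_congr_ae this]
    simp
  rw [← M.integral_incr_mul_incr_interval hA hB hst]
  exact Indep.setIntegral_eq_mul (f := fun x : ℝ × ℝ => x.1 * x.2) (ℱ.le s)
    (M.indep s t hlt A hA B hB h₁ h₂).symm
    ((M.memLp_incr hA s t h₁).1.aemeasurable.prodMk (M.memLp_incr hB s t h₂).1.aemeasurable) hF
    (by fun_prop)

variable [IsFiniteMeasure P]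

/-- The part of the longer increment beyond min t t' is orthogonal to everything known at that time,
in particular to the other increment restricted to F. -/
theorem setIntegral_incr_mul_incr_left (hℱ : UsualConditions P ℱ) (hA : A ∈ M.ring)
    (hB : B ∈ M.ring) {s t t' : ℝ≥0} (hst : s ≤ t) (hst' : s ≤ t') (h₁ h₂ : H) {F : Set Ω}
    (hF : MeasurableSet[ℱ s] F) :
    ∫ ω in F, M.incr s t A h₁ ω * M.incr s t' B h₂ ω ∂P
      = P.real F * ∫ p in Ioc s (min t t') ×ˢ (A ∩ B),
        (M.q p.1 p.2).form h₁ h₂ ∂M.timeSpace := by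
  wlog htt : t ≤ t' generalizing t t' A B h₁ h₂
  · have := this hB hA hst' hst h₂ h₁ (le_of_not_ge htt)
    simp_rw [mul_comm (M.incr s t' B h₂ _), inter_comm B, min_comm t', (M.q _ _).symm h₂] at this
    exact this
  rw [min_eq_left htt]
  have hI : ∀ r r', IntegrableOn (fun ω => M.incr s t A h₁ ω * M.incr r r' B h₂ ω) F P :=
    fun r r' => ((M.memLp_incr hA s t h₁).integrable_mul (M.memLp_incr hB r r' h₂)).integrableOn
  have e : ∀ᵐ ω ∂P.restrict F, M.incr s t A h₁ ω * M.incr s t' B h₂ ω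
      = M.incr s t A h₁ ω * M.incr s t B h₂ ω + M.incr s t A h₁ ω * M.incr t t' B h₂ ω := by
    filter_upwards [ae_restrict_of_ae (M.incr_add_incr s t t' B h₂)] with ω hω
    rw [hω, Pi.add_apply]; ring
  have hz : ∫ ω in F, M.incr s t A h₁ ω * M.incr t t' B h₂ ω ∂P = 0 := by
    have hFm := ℱ.le s F hF
    have := M.integral_mul_incr_eq_zero hB htt h₂
      ((M.stronglyMeasurable_incr hℱ hA hst h₁).indicator (ℱ.mono hst F hF))
      ((M.memLp_incr hA s t h₁).indicator hFm)
    rw [← this, ← integral_indicator hFm]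
    refine integral_congr_ae (ae_of_all _ fun ω => ?_)
    by_cases hω : ω ∈ F <;> simp [hω]
  rw [integral_congr_ae e, integral_add (hI _ _) (hI _ _), hz,
    M.setIntegral_incr_mul_incr hA hB hst h₁ h₂ hF, add_zero]

/-- The covariance of two elementary real-valued integrals. -/
theorem integral_indicator_incr_mul_indicator_incr (hℱ : UsualConditions P ℱ) (hA : A ∈ M.ring)
    (hB : B ∈ M.ring) {s t s' t' : ℝ≥0} (hst : s ≤ t) (hst' : s' ≤ t') (h₁ h₂ : H)
    {F F' : Set Ω} (hF : MeasurableSet[ℱ s] F) (hF' : MeasurableSet[ℱ s'] F') :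
    ∫ ω, F.indicator (M.incr s t A h₁) ω * F'.indicator (M.incr s' t' B h₂) ω ∂P
      = P.real (F ∩ F') * ∫ p in (Ioc s t ∩ Ioc s' t') ×ˢ (A ∩ B),
        (M.q p.1 p.2).form h₁ h₂ ∂M.timeSpace := by
  wlog hss : s ≤ s' generalizing s t s' t' A B h₁ h₂ F F'
  · have := this hB hA hst' hst h₂ h₁ hF' hF (le_of_not_ge hss)
    simp_rw [mul_comm (F'.indicator _ _), inter_comm B, inter_comm F', inter_comm (Ioc s' t'),
      (M.q _ _).symm h₂] at this
    exact this
  have hE : MeasurableSet[ℱ s'] (F ∩ F') := (ℱ.mono hss F hF).inter hF'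
  have hEm := ℱ.le s' _ hE
  have e0 : ∀ ω, F.indicator (M.incr s t A h₁) ω * F'.indicator (M.incr s' t' B h₂) ω
      = (F ∩ F').indicator (fun ω => M.incr s t A h₁ ω * M.incr s' t' B h₂ ω) ω := fun ω => by
    by_cases h1 : ω ∈ F <;> by_cases h2 : ω ∈ F' <;> simp [h1, h2]
  simp_rw [e0]
  rw [integral_indicator hEm]
  -- Whatever the first increment accumulates before s' is known at time s', hence orthogonal to the
  -- increment over (s', t'].
  have hz : ∀ r ≤ s', s ≤ r →
      ∫ ω in F ∩ F', M.incr s r A h₁ ω * M.incr s' t' B h₂ ω ∂P = 0 := fun r hr hsr => by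
    have := M.integral_mul_incr_eq_zero hB hst' h₂
      (((M.stronglyMeasurable_incr hℱ hA hsr h₁).mono (ℱ.mono hr)).indicator hE)
      ((M.memLp_incr hA s r h₁).indicator hEm)
    rw [← this, ← integral_indicator hEm]
    refine integral_congr_ae (ae_of_all _ fun ω => ?_)
    by_cases hω : ω ∈ F ∩ F' <;> simp [hω]
  rcases le_total t s' with hts | hts
  · have : Ioc s t ∩ Ioc s' t' = ∅ := by
      ext r; simp only [mem_inter_iff, mem_Ioc, mem_empty_iff_false, iff_false]
      exact fun h => absurd (h.1.2.trans hts) (not_le.2 h.2.1)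
    rw [hz t hts hst, this]
    simp
  · have hI : ∀ r r', IntegrableOn (fun ω => M.incr r r' A h₁ ω * M.incr s' t' B h₂ ω)
        (F ∩ F') P := fun r r' =>
      ((M.memLp_incr hA r r' h₁).integrable_mul (M.memLp_incr hB s' t' h₂)).integrableOn
    have e : ∀ᵐ ω ∂P.restrict (F ∩ F'), M.incr s t A h₁ ω * M.incr s' t' B h₂ ω
        = M.incr s s' A h₁ ω * M.incr s' t' B h₂ ω
          + M.incr s' t A h₁ ω * M.incr s' t' B h₂ ω := by
      filter_upwards [ae_restrict_of_ae (M.incr_add_incr s s' t A h₁)] with ω hω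
      rw [hω, Pi.add_apply]; ring
    rw [integral_congr_ae e, integral_add (hI _ _) (hI _ _), hz s' le_rfl hss, zero_add,
      M.setIntegral_incr_mul_incr_left hℱ hA hB hts hst' h₁ h₂ hE, Ioc_inter_Ioc,
      sup_eq_right.2 hss]

end CylMartingaleMeasure

/-! ### Random vectors given by their coordinates -/

section Coordinates

variable {G : Type*} [NormedAddCommGroup G] [InnerProductSpace ℝ G]

/-- Distinct basis vectors are √2 apart, so the balls of radius 1/2 around them are disjoint, and a
separable space holds only countably many disjoint open sets. -/
theorem HilbertBasis.countable_index [TopologicalSpace.SeparableSpace G] {ι : Type*}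
    (b : HilbertBasis ι ℝ G) : Countable ι := by
  refine Pairwise.countable_of_isOpen_disjoint (s := fun i => Metric.ball (b i) (1 / 2)) ?_
    (fun i => Metric.isOpen_ball) fun i => ⟨b i, Metric.mem_ball_self (by norm_num)⟩
  intro i j hij
  refine Metric.ball_disjoint_ball ?_
  have h : ‖b i - b j‖ ^ 2 = 2 := by
    rw [norm_sub_sq_real, b.orthonormal.1 i, b.orthonormal.1 j, b.orthonormal.2 hij]
    norm_num
  rw [dist_eq_norm]
  nlinarith [norm_nonneg (b i - b j)]

theorem hsNormSq_eq_tsum_adjoint {E : Type*} [NormedAddCommGroup E] [InnerProductSpace ℝ E]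
    [CompleteSpace E] [CompleteSpace G] {ι : Type*} (b : HilbertBasis ι ℝ G) (S : E →L[ℝ] G) :
    hsNormSq S = ∑' k, ‖ContinuousLinearMap.adjoint S (b k)‖ₑ ^ 2 := by
  obtain ⟨w, c, -⟩ := exists_hilbertBasis ℝ E
  rw [hsNormSq_eq_tsum c, tsum_enorm_sq_eq_adjoint c b]

theorem HilbertBasis.hasSum_of_tsum_enorm_sq_lt_top {ι : Type*} (b : HilbertBasis ι ℝ G) {c : ι → ℝ}
    (hc : ∑' k, ‖c k‖ₑ ^ 2 < ∞) :
    HasSum (fun k => c k • b k) (∑' k, c k • b k) ∧ ∀ k, ⟪b k, ∑' k, c k • b k⟫ = c k := by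
  have hs : Summable fun k => ‖c k‖ ^ 2 := by
    have h1 : ∀ k, ‖c k‖ₑ ^ 2 = ENNReal.ofReal (‖c k‖ ^ 2) := fun k => by
      rw [← ofReal_norm, ENNReal.ofReal_pow (norm_nonneg _)]
    simp_rw [h1] at hc
    have h2 := ENNReal.summable_toReal hc.ne
    simpa [ENNReal.toReal_ofReal, sq_nonneg] using h2
  have hm : Memℓp c 2 := memℓp_gen (by simpa using hs)
  have h := b.hasSum_repr_symm ⟨c, hm⟩
  refine ⟨h.summable.hasSum, fun k => ?_⟩
  rw [h.tsum_eq, ← b.repr_apply_apply, LinearIsometryEquiv.apply_symm_apply]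

variable {Ω : Type*} {mΩ : MeasurableSpace Ω} {P : Measure Ω}

theorem measurable_tsum_enorm_sq {m : MeasurableSpace Ω} {ι : Type*} [Countable ι]
    {c : ι → Ω → ℝ} (hc : ∀ k, StronglyMeasurable (c k)) :
    Measurable fun ω => ∑' k, ‖c k ω‖ₑ ^ 2 :=
  Measurable.tsum fun k => (hc k).enorm.pow_const 2

theorem ae_eq_of_forall_inner [TopologicalSpace.SeparableSpace G] {X Y : Ω → G}
    (h : ∀ g, (fun ω => ⟪X ω, g⟫) =ᵐ[P] fun ω => ⟪Y ω, g⟫) : X =ᵐ[P] Y := by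
  have := UniformSpace.secondCountable_of_separable G
  have h1 : (fun ω => X ω - Y ω) =ᵐ[P] 0 := by
    refine ae_eq_zero_of_forall_inner (𝕜 := ℝ) fun c => ?_
    filter_upwards [h c] with ω hω
    simp only [inner_sub_right, Pi.zero_apply]
    rw [real_inner_comm, hω, real_inner_comm, sub_self]
  filter_upwards [h1] with ω hω
  exact sub_eq_zero.1 hω

/-- An adapted integrable process all of whose scalar projections are modifications of martingales
is a martingale. -/
theorem martingale_of_forall_inner [CompleteSpace G] [IsFiniteMeasure P] {ι : Type*} [Preorder ι]
    {ℱ : Filtration ι mΩ} {X : ι → Ω → G} (hm : ∀ t, StronglyMeasurable[ℱ t] (X t))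
    (hi : ∀ t, Integrable (X t) P) {N : G → ι → Ω → ℝ} (hN : ∀ g, Martingale (N g) ℱ P)
    (h : ∀ t g, (fun ω => ⟪X t ω, g⟫) =ᵐ[P] N g t) : Martingale X ℱ P := by
  refine ⟨hm, fun i j hij => ?_⟩
  refine (ae_eq_condExp_of_forall_setIntegral_eq (ℱ.le i) (hi j)
    (fun _ _ _ => (hi i).integrableOn) (fun B hB _ => ?_) (hm i).aestronglyMeasurable).symm
  refine ext_inner_left ℝ fun g => ?_
  rw [← integral_inner (hi i).integrableOn, ← integral_inner (hi j).integrableOn]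
  have e : ∀ t, ∫ ω in B, ⟪g, X t ω⟫ ∂P = ∫ ω in B, N g t ω ∂P := fun t =>
    integral_congr_ae (ae_restrict_of_ae (by
      filter_upwards [h t g] with ω hω
      rw [real_inner_comm, hω]))
  rw [e, e]
  exact (hN g).setIntegral_eq hij hB

theorem tendstoInMeasure_of_tendsto_lintegral_sq {E ι : Type*} [NormedAddCommGroup E]
    {l : Filter ι} {X : ι → Ω → E}
    {Y : Ω → E} (hX : ∀ i, AEStronglyMeasurable (X i) P) (hY : AEStronglyMeasurable Y P)
    (h : Tendsto (fun i => ∫⁻ ω, ‖X i ω - Y ω‖ₑ ^ 2 ∂P) l (𝓝 0)) : TendstoInMeasure P X l Y := by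
  refine tendstoInMeasure_of_tendsto_eLpNorm (p := 2) two_ne_zero hX hY ?_
  have h1 : ∀ i, eLpNorm (X i - Y) 2 P = (∫⁻ ω, ‖X i ω - Y ω‖ₑ ^ 2 ∂P) ^ (1 / 2 : ℝ) := fun i => by
    rw [eLpNorm_eq_lintegral_rpow_enorm_toReal two_ne_zero ENNReal.ofNat_ne_top]
    simp
  simp_rw [h1]
  have := h.ennrpow_const (1 / 2 : ℝ)
  rwa [ENNReal.zero_rpow_of_pos (by norm_num)] at this

end Coordinates

/-! ### Radonification -/

namespace CylMartingaleMeasure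

variable {Ω : Type*} {mΩ : MeasurableSpace Ω} {P : Measure Ω}
  {ℱ : Filtration ℝ≥0 mΩ}
  {H : Type*} [NormedAddCommGroup H] [InnerProductSpace ℝ H]
  {U : Type*} [TopologicalSpace U] [MeasurableSpace U]
  (M : CylMartingaleMeasure P ℱ H U) {A : Set U}

/-- The uniform bound C on the forms integrates to this product. The factor λ((s, t]) is what later
gives right continuity in probability. -/
theorem lintegral_incr_sq_le (hA : A ∈ M.ring) {T : ℝ≥0} {C : ℝ}
    (hC : ∀ r ≤ T, ∀ u h, (M.q r u).form h h ≤ C * ‖h‖ ^ 2) {s t : ℝ≥0} (hst : s ≤ t) (ht : t ≤ T)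
    (h : H) :
    ∫⁻ ω, ‖M.incr s t A h ω‖ₑ ^ 2 ∂P
      ≤ ENNReal.ofReal C * M.μ A * M.lam (Ioc s t) * ‖h‖ₑ ^ 2 := by
  rcases hst.eq_or_lt with rfl | hlt
  · rw [incr_self, LinearMap.zero_apply]
    have : (fun ω => ‖(0 : Ω →ₘ[P] ℝ) ω‖ₑ ^ 2) =ᵐ[P] fun _ => 0 := by
      filter_upwards [AEEqFun.coeFn_zero (μ := P) (β := ℝ)] with ω hω
      rw [hω]; simp
    rw [lintegral_congr_ae this]
    simp
  rw [incr, M.covariance A hA s t hlt]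
  calc ∫⁻ r in Ioc s t, ∫⁻ u in A, ENNReal.ofReal ((M.q r u).val h ^ 2) ∂M.μ ∂M.lam
      ≤ ∫⁻ _ in Ioc s t, ∫⁻ _ in A, ENNReal.ofReal C * ‖h‖ₑ ^ 2 ∂M.μ ∂M.lam := by
        refine setLIntegral_mono' measurableSet_Ioc fun r hr => lintegral_mono fun u => ?_
        rw [HilbertianSeminorm.val_sq, ← ofReal_norm h, ← ENNReal.ofReal_pow (norm_nonneg _),
          ← ENNReal.ofReal_mul' (by positivity)]
        exact ENNReal.ofReal_le_ofReal (hC r (hr.2.trans ht) u h)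
    _ = _ := by simp only [lintegral_const, Measure.restrict_apply_univ]; ring

theorem incr_zero_left (hA : A ∈ M.ring) (t : ℝ≥0) (h : H) : M.incr 0 t A h = M.M t A h := by
  simp [incr, M.zero_time A hA]

/-- Continuity from above: the intervals exclude s, so they shrink to the empty set even if λ has an
atom at s. -/
theorem tendsto_lam_Ioc (s : ℝ≥0) : Tendsto (fun t => M.lam (Ioc s t)) (𝓝[>] s) (𝓝 0) := by
  have h := tendsto_measure_biInter_gt (μ := M.lam) (s := fun t => Ioc s t) (a := s)
    (fun _ _ => measurableSet_Ioc.nullMeasurableSet)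
    (fun i j _ hij => Ioc_subset_Ioc_right hij)
    ⟨s + 1, by simp, (lt_of_le_of_lt (measure_mono Ioc_subset_Iic_self) (M.lam_lt_top _)).ne⟩
  have he : ⋂ r, ⋂ (_ : r > s), Ioc s r = ∅ := by
    ext x
    simp only [mem_iInter, mem_Ioc, mem_empty_iff_false, iff_false, not_forall]
    by_cases hx : s < x
    · obtain ⟨y, hy1, hy2⟩ := exists_between hx
      exact ⟨y, hy1, fun h => absurd h.2 (not_le.2 hy2)⟩
    · exact ⟨s + 1, by simp, fun h => hx h.1⟩
  rw [he, measure_empty] at h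
  exact h

variable [CompleteSpace H]
  {G : Type*} [NormedAddCommGroup G] [InnerProductSpace ℝ G] [CompleteSpace G]
  {S : H →L[ℝ] G}

/-- A bound for the second moment of a random vector in `G` that induces the cylindrical random
variable `M((s, t], A) ∘ S*`. -/
theorem lintegral_enorm_sq_le_of_inner [TopologicalSpace.SeparableSpace G]
    (hA : A ∈ M.ring) {T : ℝ≥0} {C : ℝ}
    (hC : ∀ r ≤ T, ∀ u h, (M.q r u).form h h ≤ C * ‖h‖ ^ 2) {s t : ℝ≥0} (hst : s ≤ t) (ht : t ≤ T)
    {X : Ω → G}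
    (hX : ∀ g, (fun ω => ⟪X ω, g⟫) =ᵐ[P] M.incr s t A (ContinuousLinearMap.adjoint S g)) :
    ∫⁻ ω, ‖X ω‖ₑ ^ 2 ∂P ≤ ENNReal.ofReal C * M.μ A * M.lam (Ioc s t) * hsNormSq S := by
  obtain ⟨w, b, -⟩ := exists_hilbertBasis ℝ G
  have := b.countable_index
  have h1 : ∀ᵐ ω ∂P, ‖X ω‖ₑ ^ 2
      = ∑' k, ‖M.incr s t A (ContinuousLinearMap.adjoint S (b k)) ω‖ₑ ^ 2 := by
    filter_upwards [ae_all_iff.2 fun k => hX (b k)] with ω hω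
    rw [enorm_sq_eq_tsum_inner b]
    exact tsum_congr fun k => by rw [hω]
  rw [lintegral_congr_ae h1, lintegral_tsum fun k =>
    ((M.memLp_incr hA s t _).1.enorm.pow_const 2), hsNormSq_eq_tsum_adjoint b,
    ← ENNReal.tsum_mul_left]
  exact ENNReal.tsum_le_tsum fun k => M.lintegral_incr_sq_le hA hC hst ht _

/-- The cylindrical random variable `M(t, A) ∘ S*` is induced by a random vector. -/
theorem exists_radonification [BorelSpace U] [IsFiniteMeasure P]
    [TopologicalSpace.SeparableSpace G] (hA : A ∈ M.ring)
    (hS : IsHilbertSchmidt S) (t : ℝ≥0) :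
    ∃ Z : Ω → G, StronglyMeasurable[ℱ t] Z ∧ MemLp Z 2 P ∧
      ∀ g, (fun ω => ⟪Z ω, g⟫) =ᵐ[P] M.M t A (ContinuousLinearMap.adjoint S g) := by
  classical
  obtain ⟨w, b, -⟩ := exists_hilbertBasis ℝ G
  have := b.countable_index
  obtain ⟨C, hC0, hC⟩ := M.exists_form_le t
  set c : w → Ω → ℝ := fun k => M.M t A (ContinuousLinearMap.adjoint S (b k)) with hc
  have hcm : ∀ k, StronglyMeasurable[ℱ t] (c k) := fun k =>
    (M.martingale A hA _).stronglyMeasurable t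
  have hK : ENNReal.ofReal C * M.μ A * M.lam (Ioc 0 t) * hsNormSq S < ∞ := by
    refine ENNReal.mul_lt_top (ENNReal.mul_lt_top (ENNReal.mul_lt_top ENNReal.ofReal_lt_top
      (M.μ_lt_top A hA)) ?_) hS
    exact lt_of_le_of_lt (measure_mono Ioc_subset_Iic_self) (M.lam_lt_top t)
  have hsum : ∫⁻ ω, ∑' k, ‖c k ω‖ₑ ^ 2 ∂P < ∞ := by
    rw [lintegral_tsum fun k => ((hcm k).mono (ℱ.le t)).aestronglyMeasurable.enorm.pow_const 2]
    refine lt_of_le_of_lt ?_ hK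
    rw [hsNormSq_eq_tsum_adjoint b, ← ENNReal.tsum_mul_left]
    refine ENNReal.tsum_le_tsum fun k => ?_
    have := M.lintegral_incr_sq_le hA hC (zero_le : 0 ≤ t) le_rfl
      (ContinuousLinearMap.adjoint S (b k))
    rwa [M.incr_zero_left hA] at this
  -- Cutting the coordinates off outside this almost sure event makes the series converge for every
  -- ω; E belongs to ℱ t because the basis is countable, so the limit stays adapted.
  set E : Set Ω := {ω | ∑' k, ‖c k ω‖ₑ ^ 2 < ∞} with hE
  have hmeas : Measurable[ℱ t] fun ω => ∑' k, ‖c k ω‖ₑ ^ 2 :=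
    measurable_tsum_enorm_sq hcm
  have hEm : MeasurableSet[ℱ t] E := measurableSet_lt hmeas measurable_const
  have hEae : ∀ᵐ ω ∂P, ω ∈ E := ae_lt_top (hmeas.mono (ℱ.le t) le_rfl) hsum.ne
  set c' : w → Ω → ℝ := fun k => E.indicator (c k) with hc'
  have hc'm : ∀ k, StronglyMeasurable[ℱ t] (c' k) := fun k => (hcm k).indicator hEm
  have hfin : ∀ ω, ∑' k, ‖c' k ω‖ₑ ^ 2 < ∞ := fun ω => by
    by_cases hω : ω ∈ E
    · simpa [hc', hω] using (show ∑' k, ‖c k ω‖ₑ ^ 2 < ∞ from hω)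
    · simp [hc', hω]
  set Z : Ω → G := fun ω => ∑' k, c' k ω • b k with hZ
  have hZb : ∀ k ω, ⟪b k, Z ω⟫ = c' k ω := fun k ω =>
    (b.hasSum_of_tsum_enorm_sq_lt_top (hfin ω)).2 k
  have hZm : StronglyMeasurable[ℱ t] Z := by
    refine stronglyMeasurable_of_tendsto (atTop : Filter (Finset w))
      (f := fun s ω => ∑ k ∈ s, c' k ω • b k) (fun s => ?_) ?_
    · exact Finset.stronglyMeasurable_fun_sum s fun k _ =>
        (hc'm k).smul stronglyMeasurable_const
    · exact tendsto_pi_nhds.2 fun ω => (b.hasSum_of_tsum_enorm_sq_lt_top (hfin ω)).1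
  have hin : ∀ g, (fun ω => ⟪Z ω, g⟫) =ᵐ[P] M.M t A (ContinuousLinearMap.adjoint S g) := by
    -- The vectors g for which the identity holds form a subspace, and it contains the basis by
    -- construction.
    let W : Submodule ℝ G :=
      { carrier := {g | (fun ω => ⟪Z ω, g⟫) =ᵐ[P] M.M t A (ContinuousLinearMap.adjoint S g)}
        zero_mem' := by
          simp only [mem_ofPred_eq, map_zero, inner_zero_right]
          exact AEEqFun.coeFn_zero.symm
        add_mem' := by
          intro g g' hg hg'
          simp only [mem_ofPred_eq, map_add, inner_add_right] at *
          exact (hg.add hg').trans (AEEqFun.coeFn_add _ _).symm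
        smul_mem' := by
          intro a g hg
          simp only [mem_ofPred_eq, map_smul, inner_smul_right] at *
          exact (hg.const_smul a).trans (AEEqFun.coeFn_smul _ _).symm }
    have hbW : Submodule.span ℝ (range b) ≤ W := by
      rw [Submodule.span_le]
      rintro _ ⟨k, rfl⟩
      change (fun ω => ⟪Z ω, b k⟫) =ᵐ[P] _
      filter_upwards [hEae] with ω hω
      rw [real_inner_comm, hZb]
      simp [hc', hω, hc]
    intro g
    have hg : g ∈ closure (Submodule.span ℝ (range b) : Set G) := by
      have : g ∈ (Submodule.span ℝ (range b)).topologicalClosure := by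
        rw [b.dense_span]; trivial
      exact this
    obtain ⟨x, hx, hxg⟩ := mem_closure_iff_seq_limit.1 hg
    -- From the dense span to all of G: M(t, A) is continuous in probability, and an almost surely
    -- convergent subsequence identifies the limit pointwise.
    have h1 : TendstoInMeasure P
        (fun n => ⇑(M.M t A (ContinuousLinearMap.adjoint S (x n)))) atTop
        (M.M t A (ContinuousLinearMap.adjoint S g)) :=
      (M.continuous A hA t _).comp
        (((ContinuousLinearMap.adjoint S).continuous.tendsto g).comp hxg)
    obtain ⟨ns, hns, h2⟩ := h1.exists_seq_tendsto_ae'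
    have h3 : ∀ᵐ ω ∂P, ∀ n, ⟪Z ω, x n⟫ = M.M t A (ContinuousLinearMap.adjoint S (x n)) ω :=
      ae_all_iff.2 fun n => hbW (hx n)
    filter_upwards [h2, h3] with ω h2 h3
    refine tendsto_nhds_unique ?_ h2
    simp_rw [← h3]
    exact ((continuous_const.inner continuous_id).tendsto g).comp (hxg.comp hns)
  refine ⟨Z, hZm, ⟨(hZm.mono (ℱ.le t)).aestronglyMeasurable, ?_⟩, hin⟩
  have hle := M.lintegral_enorm_sq_le_of_inner (S := S) hA hC (zero_le : 0 ≤ t) le_rfl (X := Z)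
    fun g => by rw [M.incr_zero_left hA]; exact hin g
  rw [eLpNorm_lt_top_iff_lintegral_rpow_enorm_lt_top two_ne_zero ENNReal.ofNat_ne_top]
  simpa using hle.trans_lt hK

end CylMartingaleMeasure

/-! ### Martingales stopped at, or started from, a deterministic time -/

section Martingales

variable {Ω : Type*} {mΩ : MeasurableSpace Ω} {P : Measure Ω}
  {G : Type*} [NormedAddCommGroup G]

theorem isCadlag_const {T : ℝ≥0} (g : G) : IsCadlag fun _ : Iic T => g := fun _ =>
  ⟨continuousWithinAt_const, g, tendsto_const_nhds⟩

theorem IsCadlag.sub {T : ℝ≥0} {f g : Iic T → G} (hf : IsCadlag f) (hg : IsCadlag g) :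
    IsCadlag fun t => f t - g t := fun t =>
  ⟨(hf t).1.sub (hg t).1, by
    obtain ⟨a, ha⟩ := (hf t).2
    obtain ⟨b, hb⟩ := (hg t).2
    exact ⟨a - b, ha.sub hb⟩⟩

variable [InnerProductSpace ℝ G] [CompleteSpace G] [IsFiniteMeasure P]

theorem MeasureTheory.Martingale.min_const {ι : Type*} [LinearOrder ι] {ℱ : Filtration ι mΩ}
    {X : ι → Ω → G} (hX : Martingale X ℱ P) (t : ι) : Martingale (fun r => X (min t r)) ℱ P := by
  refine ⟨fun r => (hX.stronglyMeasurable _).mono (ℱ.mono (min_le_right _ _)), fun i j hij => ?_⟩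
  rcases le_total i t with h | h
  · simp only [min_eq_right h]
    exact hX.condExp_ae_eq (le_min h hij)
  · simp only [min_eq_left h, min_eq_left (h.trans hij)]
    rw [condExp_of_stronglyMeasurable (ℱ.le i) ((hX.stronglyMeasurable t).mono (ℱ.mono h))
      (hX.integrable t)]

/-- A martingale that vanishes until time `s` remains a martingale when it is restricted to an event
of the past of `s`. -/
theorem MeasureTheory.Martingale.indicator_of_ae_eq_zero [SecondCountableTopology G]
    {ι : Type*} [LinearOrder ι]
    {ℱ : Filtration ι mΩ} (hnull : ∀ t, ∀ N : Set Ω, P N = 0 → MeasurableSet[ℱ t] N)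
    {X : ι → Ω → G} (hX : Martingale X ℱ P) {s : ι} (h0 : ∀ r ≤ s, X r =ᵐ[P] 0)
    {F : Set Ω} (hF : MeasurableSet[ℱ s] F) : Martingale (fun r => F.indicator (X r)) ℱ P := by
  have hz : ∀ r ≤ s, F.indicator (X r) =ᵐ[P] 0 := fun r hr => by
    filter_upwards [h0 r hr] with ω hω
    by_cases h : ω ∈ F <;> simp [h, hω]
  have hm : ∀ r, StronglyMeasurable[ℱ r] (F.indicator (X r)) := fun r => by
    rcases le_total s r with h | h
    · exact (hX.stronglyMeasurable r).indicator (ℱ.mono h F hF)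
    · exact stronglyMeasurable_zero.congr_of_null_mem (hnull r) (hz r h).symm
  have hi : ∀ r, Integrable (F.indicator (X r)) P := fun r =>
    (hX.integrable r).indicator (ℱ.le s F hF)
  refine ⟨hm, fun i j hij => ?_⟩
  refine (ae_eq_condExp_of_forall_setIntegral_eq (ℱ.le i) (hi j)
    (fun _ _ _ => (hi i).integrableOn) (fun B hB _ => ?_) (hm i).aestronglyMeasurable).symm
  have hFm := ℱ.le s F hF
  rcases le_total s i with h | h
  · rw [setIntegral_indicator hFm, setIntegral_indicator hFm]
    exact hX.setIntegral_eq hij (hB.inter (ℱ.mono h F hF))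
  -- If i precedes s the left side is zero. For j after s, the integral of X_j over B ∩ F is pulled
  -- back to time s, where X vanishes.
  · rw [integral_eq_zero_of_ae (ae_restrict_of_ae (hz i h))]
    rcases le_total s j with h' | h'
    · rw [setIntegral_indicator hFm, ← hX.setIntegral_eq h' ((ℱ.mono h B hB).inter hF),
        integral_eq_zero_of_ae (ae_restrict_of_ae (h0 s le_rfl))]
    · rw [integral_eq_zero_of_ae (ae_restrict_of_ae (hz j h'))]

end Martingales

/-! ### Radonified processes -/

namespace CylMartingaleMeasure

variable {Ω : Type*} {mΩ : MeasurableSpace Ω} {P : Measure Ω} {ℱ : Filtration ℝ≥0 mΩ}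
  {H : Type*} [NormedAddCommGroup H] [InnerProductSpace ℝ H] [CompleteSpace H]
  {U : Type*} [TopologicalSpace U] [MeasurableSpace U]
  {M : CylMartingaleMeasure P ℱ H U} {T : ℝ≥0}
  {G : Type*} [NormedAddCommGroup G] [InnerProductSpace ℝ G] [CompleteSpace G]
  [TopologicalSpace.SeparableSpace G]

theorem restrictTime_null_mem (hℱ : UsualConditions P ℱ) (t : Iic T) (N : Set Ω) (hN : P N = 0) :
    MeasurableSet[restrictTime ℱ T t] N :=
  ℱ.mono (zero_le : 0 ≤ (t : ℝ≥0)) N (hℱ.null_mem N hN)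

/-- The scalar projections fix each Y_r almost surely, as G is separable; right continuity makes the
exceptional null set independent of r. -/
theorem IsRadonified.ae_eq {s t : ℝ≥0} {A : Set U} {S : H →L[ℝ] G} {Y Y' : Iic T → Ω → G}
    (hY : M.IsRadonified T s t A S Y) (hY' : M.IsRadonified T s t A S Y') (hT : 0 < T) :
    ∀ᵐ ω ∂P, ∀ r, Y r ω = Y' r ω :=
  ae_forall_eq_of_forall_ae_eq hT (fun ω r => (hY.isMartingale.cadlag ω r).1)
    (fun ω r => (hY'.isMartingale.cadlag ω r).1) fun r =>
      ae_eq_of_forall_inner fun g => (hY.version r g).trans (hY'.version r g).symm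

/-- Before time `s`, the radonified process vanishes. -/
theorem IsRadonified.ae_eq_zero {s t : ℝ≥0} {A : Set U} {S : H →L[ℝ] G} {Y : Iic T → Ω → G}
    (hY : M.IsRadonified T s t A S Y) (hst : s ≤ t) {r : Iic T} (hr : (r : ℝ≥0) ≤ s) :
    Y r =ᵐ[P] 0 := by
  refine ae_eq_of_forall_inner fun g => (hY.version r g).trans ?_
  rw [min_eq_right hr, min_eq_right (hr.trans hst), incr_self, LinearMap.zero_apply]
  filter_upwards [AEEqFun.coeFn_zero (μ := P) (β := ℝ)] with ω hω
  rw [hω]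
  simp

variable [BorelSpace U] [IsFiniteMeasure P]

/-- The vectors radonifying M(·, A)∘S* form a martingale because their projections do. Stopped at t,
it is right continuous in probability since E‖Z_{t∧r'} − Z_{t∧r}‖² is at most a constant times λ((r,
r']). -/
theorem exists_cadlag_stopped (hℱ : UsualConditions P ℱ) (hT : 0 < T) {A : Set U}
    (hA : A ∈ M.ring) {S : H →L[ℝ] G} (hS : IsHilbertSchmidt S) (t : ℝ≥0) :
    ∃ Y : Iic T → Ω → G, IsCadlagL2Martingale P ℱ T Y ∧ ∀ (r : Iic T) g,
      (fun ω => ⟪Y r ω, g⟫) =ᵐ[P] M.M (min t r) A (ContinuousLinearMap.adjoint S g) := by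
  choose Z hZm hZ2 hZ using fun t => M.exists_radonification (P := P) (G := G) hA hS t
  have hZmart : Martingale Z ℱ P := martingale_of_forall_inner hZm
    (fun t => (hZ2 t).integrable one_le_two)
    (fun g => M.martingale A hA (ContinuousLinearMap.adjoint S g)) hZ
  have hmart : Martingale (fun r : Iic T => Z (min t r)) (restrictTime ℱ T) P :=
    ⟨fun r => (hZmart.min_const t).1 r, fun i j hij => (hZmart.min_const t).2 _ _ hij⟩
  obtain ⟨C, -, hC⟩ := M.exists_form_le T
  have hrc : ∀ r : Iic T, TendstoInMeasure P (fun r : Iic T => Z (min t r)) (𝓝[>] r)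
      (Z (min t r)) := by
    intro r
    refine tendstoInMeasure_of_tendsto_lintegral_sq (fun _ => (hZ2 _).1) (hZ2 _).1 ?_
    have hsub : Tendsto ((↑) : Iic T → ℝ≥0) (𝓝[>] r) (𝓝[>] (r : ℝ≥0)) :=
      tendsto_nhdsWithin_iff.2 ⟨(continuous_subtype_val.tendsto r).mono_left nhdsWithin_le_nhds,
        eventually_nhdsWithin_of_forall fun x hx => hx⟩
    have hK : ENNReal.ofReal C * M.μ A * hsNormSq S ≠ ∞ :=
      (ENNReal.mul_lt_top (ENNReal.mul_lt_top ENNReal.ofReal_lt_top (M.μ_lt_top A hA)) hS).ne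
    have hlim := ENNReal.Tendsto.const_mul ((M.tendsto_lam_Ioc r).comp hsub) (Or.inr hK)
    rw [mul_zero] at hlim
    refine tendsto_of_tendsto_of_tendsto_of_le_of_le' tendsto_const_nhds hlim
      (Eventually.of_forall fun _ => zero_le) ?_
    filter_upwards [self_mem_nhdsWithin] with r' hr'
    have hrr : (r : ℝ≥0) ≤ r' := le_of_lt hr'
    refine (M.lintegral_enorm_sq_le_of_inner (S := S) hA hC (s := min t r) (t := min t r')
      (min_le_min_left _ hrr) ((min_le_right _ _).trans r'.2)
      (X := fun ω => Z (min t r') ω - Z (min t r) ω) fun g => ?_).trans ?_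
    · filter_upwards [hZ (min t r') g, hZ (min t r) g,
        M.coeFn_incr (min t r) (min t r') A (ContinuousLinearMap.adjoint S g)] with ω h1 h2 h3
      rw [inner_sub_left, h1, h2, h3]
    · have hIoc : Ioc (min t r) (min t r') ⊆ Ioc (r : ℝ≥0) r' := fun x hx => by
        refine ⟨?_, hx.2.trans (min_le_right _ _)⟩
        rcases min_lt_iff.1 hx.1 with h | h
        · exact absurd (hx.2.trans (min_le_left _ _)) (not_le.2 h)
        · exact h
      rw [mul_right_comm]
      simp only [Function.comp_apply]
      gcongr
  obtain ⟨Y, hY1, hY2, hY3, hY4⟩ := exists_cadlag_modification hT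
    (restrictTime_null_mem hℱ) hmart (fun r => hZ2 _) hrc
  refine ⟨Y, ⟨hY1, hY2, hY3⟩, fun r g => ?_⟩
  filter_upwards [hY4 r, hZ (min t r) g] with ω h1 h2
  rw [h1, h2]

/-- The process is the difference of the càdlàg versions stopped at t and at s. -/
theorem exists_isRadonified (hℱ : UsualConditions P ℱ) (hT : 0 < T) (s t : ℝ≥0) {A : Set U}
    (hA : A ∈ M.ring) {S : H →L[ℝ] G} (hS : IsHilbertSchmidt S) :
    ∃ Y, M.IsRadonified T s t A S Y := by
  obtain ⟨Y, hY, hYv⟩ := exists_cadlag_stopped hℱ hT hA hS t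
  obtain ⟨Y', hY', hYv'⟩ := exists_cadlag_stopped hℱ hT hA hS s
  refine ⟨fun r ω => Y r ω - Y' r ω, ⟨hY.martingale.sub hY'.martingale,
    fun r => (hY.memLp r).sub (hY'.memLp r), fun ω => (hY.cadlag ω).sub (hY'.cadlag ω)⟩,
    fun r g => ?_⟩
  filter_upwards [hYv r g, hYv' r g,
    M.coeFn_incr (min s r) (min t r) A (ContinuousLinearMap.adjoint S g)] with ω h1 h2 h3
  rw [inner_sub_left, h1, h2, h3]

end CylMartingaleMeasure

/-! ### Elementary integrands and the isometry -/

namespace CylMartingaleMeasure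

variable {Ω : Type*} {mΩ : MeasurableSpace Ω} {P : Measure Ω} {ℱ : Filtration ℝ≥0 mΩ}
  {H : Type*} [NormedAddCommGroup H] [InnerProductSpace ℝ H] [CompleteSpace H]
  {U : Type*} [TopologicalSpace U] [MeasurableSpace U]

/-- The data `(s, t, F, A, S)` of an elementary integrand `1_{]s, t]} 1_F 1_A S`, with a version of
the radonified process `Y(s, t, A, S)`. -/
structure Elementary (M : CylMartingaleMeasure P ℱ H U) (T : ℝ≥0)
    (G : Type*) [NormedAddCommGroup G] [InnerProductSpace ℝ G] [CompleteSpace G] where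
  s : ℝ≥0
  t : ℝ≥0
  F : Set Ω
  A : Set U
  S : H →L[ℝ] G
  Y : Iic T → Ω → G
  lt : s < t
  le : t ≤ T
  meas_F : MeasurableSet[ℱ s] F
  mem_A : A ∈ M.ring
  isRadonified : M.IsRadonified T s t A S Y

namespace Elementary

variable {M : CylMartingaleMeasure P ℱ H U} {T : ℝ≥0}
  {G : Type*} [NormedAddCommGroup G] [InnerProductSpace ℝ G] [CompleteSpace G]
  (e e' : M.Elementary T G)

/-- The scalar factor `1_{]s, t]}(r) 1_F(ω) 1_A(u)`. -/
def coeff (r : ℝ≥0) (ω : Ω) (u : U) : ℝ :=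
  (Ioc e.s e.t).indicator (1 : ℝ≥0 → ℝ) r * e.F.indicator (1 : Ω → ℝ) ω
    * e.A.indicator (1 : U → ℝ) u

/-- The elementary integrand. -/
def family : M.OpFamily G := fun r ω u =>
  e.coeff r ω u • e.S.comp (ContinuousLinearMap.adjoint (M.q r u).incl)

/-- The integral process of the elementary integrand. -/
def process : Iic T → Ω → G := fun r => e.F.indicator (e.Y r)

/-- The scalar projections of the integral process. -/
def proj (r : ℝ≥0) (g : G) : Ω → ℝ :=
  e.F.indicator (M.incr (min e.s r) (min e.t r) e.A (ContinuousLinearMap.adjoint e.S g))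

theorem measurableSet_F : MeasurableSet e.F := ℱ.le _ _ e.meas_F

theorem inner_process (r : Iic T) (g : G) :
    (fun ω => ⟪e.process r ω, g⟫) =ᵐ[P] e.proj r g := by
  filter_upwards [e.isRadonified.version r g] with ω hω
  by_cases h : ω ∈ e.F
  · simpa [process, proj, h] using hω
  · simp [process, proj, h]

theorem memLp_proj (r : ℝ≥0) (g : G) : MemLp (e.proj r g) 2 P :=
  (M.memLp_incr e.mem_A _ _ _).indicator e.measurableSet_F

/-- Y vanishes up to time s and F belongs to ℱ s, so the factor 1_F preserves the martingale
property. The mean is constant in time and is zero at time 0. -/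
theorem process_mem [IsFiniteMeasure P] [TopologicalSpace.SeparableSpace G]
    (hℱ : UsualConditions P ℱ) : e.process ∈ l2Martingales P ℱ T G := by
  have := UniformSpace.secondCountable_of_separable G
  have hmart : Martingale e.process (restrictTime ℱ T) P :=
    e.isRadonified.isMartingale.martingale.indicator_of_ae_eq_zero
      (restrictTime_null_mem hℱ) (s := ⟨e.s, e.lt.le.trans e.le⟩)
      (fun r hr => e.isRadonified.ae_eq_zero e.lt.le hr) e.meas_F
  refine ⟨⟨hmart, fun t => (e.isRadonified.isMartingale.memLp t).indicator e.measurableSet_F,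
    fun ω => ?_⟩, fun t => ?_⟩
  · by_cases h : ω ∈ e.F
    · simpa [process, h] using e.isRadonified.isMartingale.cadlag ω
    · simpa [process, h] using isCadlag_const (T := T) (0 : G)
  · have h0 : (⟨0, mem_Iic.2 zero_le⟩ : Iic T) ≤ t := (zero_le : 0 ≤ (t : ℝ≥0))
    have h1 := hmart.setIntegral_eq h0 MeasurableSet.univ
    rw [setIntegral_univ, setIntegral_univ] at h1
    rw [← h1]
    refine integral_eq_zero_of_ae ?_
    filter_upwards [e.isRadonified.ae_eq_zero e.lt.le (r := ⟨0, mem_Iic.2 zero_le⟩) zero_le]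
      with ω hω
    by_cases h : ω ∈ e.F <;> simp [process, h, hω]

variable (M) in
/-- The measure `P ⊗ λ ⊗ μ` on `Ω × (0, r] × U`. -/
def energyMeasure (r : ℝ≥0) : Measure (Ω × (ℝ≥0 × U)) :=
  P.prod ((M.lam.restrict (Ioc 0 r)).prod M.μ)

/-- Separates the dependence on ω from that on (r, u), so that integrals over the product space
factor. -/
theorem coeff_mul_coeff_mul (r : ℝ≥0) (ω : Ω) (u : U) (h h' : H) :
    e.coeff r ω u * e'.coeff r ω u * (M.q r u).form h h'
      = (e.F ∩ e'.F).indicator (1 : Ω → ℝ) ω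
        * ((Ioc e.s e.t ∩ Ioc e'.s e'.t) ×ˢ (e.A ∩ e'.A)).indicator
          (fun p : ℝ≥0 × U => (M.q p.1 p.2).form h h') (r, u) := by
  simp only [coeff, indicator_apply, Pi.one_apply]
  by_cases h1 : r ∈ Ioc e.s e.t <;> by_cases h2 : r ∈ Ioc e'.s e'.t <;>
  by_cases h3 : ω ∈ e.F <;> by_cases h4 : ω ∈ e'.F <;>
  by_cases h5 : u ∈ e.A <;> by_cases h6 : u ∈ e'.A <;> simp [h1, h2, h3, h4, h5, h6]

variable {κ : Type*} (E : Finset κ) (a : κ → ℝ) (v : κ → M.Elementary T G)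

/-- The adjoint of S∘i_q* is i_q∘S*, so it maps G into the image of H. Norms in the varying space
H_q thereby become values of the form q on H. -/
theorem adjoint_sum_family (r : ℝ≥0) (ω : Ω) (u : U) (g : G) :
    ContinuousLinearMap.adjoint ((∑ k ∈ E, a k • (v k).family) r ω u) g
      = (M.q r u).incl (∑ k ∈ E, (a k * (v k).coeff r ω u) •
        ContinuousLinearMap.adjoint (v k).S g) := by
  have h1 : (∑ k ∈ E, a k • (v k).family) r ω u
      = ∑ k ∈ E, a k • (v k).family r ω u := by
    simp only [Finset.sum_apply, Pi.smul_apply]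
  rw [h1, map_sum, _root_.sum_apply, map_sum]
  refine Finset.sum_congr rfl fun k _ => ?_
  simp [family, smul_smul, ContinuousLinearMap.adjoint_comp]

theorem enorm_adjoint_sum_family_sq (r : ℝ≥0) (ω : Ω) (u : U) (g : G) :
    ‖ContinuousLinearMap.adjoint ((∑ k ∈ E, a k • (v k).family) r ω u) g‖ₑ ^ 2
      = ENNReal.ofReal (∑ k ∈ E, ∑ l ∈ E, a k * a l * ((v k).coeff r ω u * (v l).coeff r ω u
        * (M.q r u).form (ContinuousLinearMap.adjoint (v k).S g)
          (ContinuousLinearMap.adjoint (v l).S g))) := by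
  rw [adjoint_sum_family, ← ofReal_norm, ← ENNReal.ofReal_pow (norm_nonneg _),
    HilbertianSeminorm.norm_incl, HilbertianSeminorm.val_sq, HilbertianSeminorm.form_sum]
  congr 1
  exact Finset.sum_congr rfl fun k _ => Finset.sum_congr rfl fun l _ => by ring

variable [BorelSpace U]

theorem measurable_coeff : Measurable fun z : Ω × (ℝ≥0 × U) => e.coeff z.2.1 z.1 z.2.2 := by
  have h1 : Measurable ((Ioc e.s e.t).indicator (1 : ℝ≥0 → ℝ)) :=
    measurable_one.indicator measurableSet_Ioc
  have h2 : Measurable (e.F.indicator (1 : Ω → ℝ)) := measurable_one.indicator e.measurableSet_F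
  have h3 : Measurable (e.A.indicator (1 : U → ℝ)) :=
    measurable_one.indicator (M.measurableSet_of_mem_ring e.mem_A)
  exact ((h1.comp (measurable_fst.comp measurable_snd)).mul (h2.comp measurable_fst)).mul
    (h3.comp (measurable_snd.comp measurable_snd))

theorem measurable_adjoint_sum_family (g : G) :
    Measurable fun z : Ω × (ℝ≥0 × U) => ‖ContinuousLinearMap.adjoint
        ((∑ k ∈ E, a k • (v k).family) z.2.1 z.1 z.2.2) g‖ₑ ^ 2 := by
  simp_rw [enorm_adjoint_sum_family_sq]
  refine Measurable.ennreal_ofReal (Finset.measurable_sum _ fun k _ =>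
    Finset.measurable_sum _ fun l _ => Measurable.const_mul ?_ _)
  exact ((v k).measurable_coeff.mul (v l).measurable_coeff).mul
    ((M.measurable_q _ _).comp measurable_snd)

variable [IsFiniteMeasure P]

theorem integrable_coeff_mul (r : ℝ≥0) (h h' : H) :
    Integrable (fun z : Ω × (ℝ≥0 × U) => e.coeff z.2.1 z.1 z.2.2 * e'.coeff z.2.1 z.1 z.2.2
      * (M.q z.2.1 z.2.2).form h h') (energyMeasure M r) := by
  have hA := M.isSetRing.inter_mem e.mem_A e'.mem_A
  have hD : MeasurableSet ((Ioc e.s e.t ∩ Ioc e'.s e'.t) ×ˢ (e.A ∩ e'.A)) :=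
    (measurableSet_Ioc.inter measurableSet_Ioc).prod (M.measurableSet_of_mem_ring hA)
  simp_rw [coeff_mul_coeff_mul]
  refine Integrable.mul_prod (f := (e.F ∩ e'.F).indicator (1 : Ω → ℝ)) ?_ ?_
  · exact (integrable_const (1 : ℝ)).indicator (e.measurableSet_F.inter e'.measurableSet_F)
  · rw [integrable_indicator_iff hD]
    have h1 := M.integrableOn_form hA (T := e.t)
      (D := (Ioc e.s e.t ∩ Ioc e'.s e'.t) ×ˢ (e.A ∩ e'.A))
      (prod_mono (fun x hx => hx.1.2) le_rfl) h h'
    refine Integrable.mono_measure h1 (Measure.restrict_mono le_rfl ?_)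
    exact Measure.prod_mono Measure.restrict_le_self le_rfl

theorem integral_coeff_mul (hℱ : UsualConditions P ℱ) (r : ℝ≥0) (g : G) :
    ∫ z, e.coeff z.2.1 z.1 z.2.2 * e'.coeff z.2.1 z.1 z.2.2
      * (M.q z.2.1 z.2.2).form (ContinuousLinearMap.adjoint e.S g)
        (ContinuousLinearMap.adjoint e'.S g) ∂(energyMeasure M r)
      = ∫ ω, e.proj r g ω * e'.proj r g ω ∂P := by
  have hA := M.isSetRing.inter_mem e.mem_A e'.mem_A
  have hD : MeasurableSet ((Ioc e.s e.t ∩ Ioc e'.s e'.t) ×ˢ (e.A ∩ e'.A)) :=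
    (measurableSet_Ioc.inter measurableSet_Ioc).prod (M.measurableSet_of_mem_ring hA)
  simp_rw [coeff_mul_coeff_mul]
  rw [energyMeasure, integral_prod_mul ((e.F ∩ e'.F).indicator (1 : Ω → ℝ)),
    integral_indicator_one (e.measurableSet_F.inter e'.measurableSet_F), integral_indicator hD]
  -- Restricting the energy to (0, r] amounts to replacing t by min t r, as in the truncated
  -- processes.
  have hrestr : ((M.lam.restrict (Ioc 0 r)).prod M.μ).restrict
      ((Ioc e.s e.t ∩ Ioc e'.s e'.t) ×ˢ (e.A ∩ e'.A))
      = M.timeSpace.restrict ((Ioc e.s (min e.t r) ∩ Ioc e'.s (min e'.t r)) ×ˢ (e.A ∩ e'.A)) := by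
    rw [← Measure.prod_restrict, ← Measure.prod_restrict,
      Measure.restrict_restrict (measurableSet_Ioc.inter measurableSet_Ioc)]
    congr 2
    ext x
    simp only [mem_inter_iff, mem_Ioc, le_min_iff]
    constructor
    · rintro ⟨⟨⟨h1, h2⟩, h3, h4⟩, -, h6⟩
      exact ⟨⟨h1, h2, h6⟩, h3, h4, h6⟩
    · rintro ⟨⟨h1, h2, h6⟩, h3, h4, -⟩
      exact ⟨⟨⟨h1, h2⟩, h3, h4⟩, zero_le.trans_lt h1, h6⟩
  rw [hrestr]
  -- Before its starting time an elementary integral is zero; these cases are split off so that min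
  -- s r = s in the covariance formula.
  have hzero : ∀ e : M.Elementary T G, r ≤ e.s → e.proj r g =ᵐ[P] 0 := fun e he => by
    rw [proj, min_eq_right he, min_eq_right (he.trans e.lt.le), incr_self, LinearMap.zero_apply]
    filter_upwards [AEEqFun.coeFn_zero (μ := P) (β := ℝ)] with ω hω
    by_cases h : ω ∈ e.F <;> simp [h, hω]
  rcases le_total r e.s with hr | hr
  · rw [Ioc_eq_empty_of_le ((min_le_right _ _).trans hr), integral_eq_zero_of_ae (μ := P)]
    · simp
    · filter_upwards [hzero e hr] with ω hω
      simp [hω]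
  rcases le_total r e'.s with hr' | hr'
  · rw [Ioc_eq_empty_of_le ((min_le_right e'.t r).trans hr'), integral_eq_zero_of_ae (μ := P)]
    · simp
    · filter_upwards [hzero e' hr'] with ω hω
      simp [hω]
  rw [proj, proj, min_eq_left hr, min_eq_left hr',
    M.integral_indicator_incr_mul_indicator_incr hℱ e.mem_A e'.mem_A (le_min e.lt.le hr)
      (le_min e'.lt.le hr') _ _ e.meas_F e'.meas_F]

/-- The isometry for the scalar projections of the integral process. -/
theorem lintegral_adjoint_sum_family (hℱ : UsualConditions P ℱ) (r : ℝ≥0) (g : G) :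
    ∫⁻ z, ‖ContinuousLinearMap.adjoint
        ((∑ k ∈ E, a k • (v k).family) z.2.1 z.1 z.2.2) g‖ₑ ^ 2 ∂(energyMeasure M r)
      = ∫⁻ ω, ‖∑ k ∈ E, a k * (v k).proj r g ω‖ₑ ^ 2 ∂P := by
  have hint : ∀ k l, Integrable (fun z : Ω × (ℝ≥0 × U) => a k * a l *
      ((v k).coeff z.2.1 z.1 z.2.2 * (v l).coeff z.2.1 z.1 z.2.2
        * (M.q z.2.1 z.2.2).form (ContinuousLinearMap.adjoint (v k).S g)
          (ContinuousLinearMap.adjoint (v l).S g))) (energyMeasure M r) := fun k l =>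
    ((v k).integrable_coeff_mul (v l) r _ _).const_mul _
  have hp : MemLp (fun ω => ∑ k ∈ E, a k * (v k).proj r g ω) 2 P :=
    memLp_finsetSum E fun k _ => ((v k).memLp_proj r g).const_mul (a k)
  have hpp : ∀ k l, Integrable (fun ω => a k * a l * ((v k).proj r g ω * (v l).proj r g ω)) P :=
    fun k l => (((v k).memLp_proj r g).integrable_mul ((v l).memLp_proj r g)).const_mul _
  rw [hp.lintegral_enorm_sq]
  simp_rw [enorm_adjoint_sum_family_sq]
  rw [← ofReal_integral_eq_lintegral_ofReal
    (integrable_finsetSum _ fun k _ => integrable_finsetSum _ fun l _ => hint k l)]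
  · congr 1
    rw [integral_finsetSum _ fun k _ => integrable_finsetSum _ fun l _ => hint k l]
    have h1 : ∀ ω, ‖∑ k ∈ E, a k * (v k).proj r g ω‖ ^ 2
        = ∑ k ∈ E, ∑ l ∈ E, a k * a l * ((v k).proj r g ω * (v l).proj r g ω) := fun ω => by
      rw [Real.norm_eq_abs, sq_abs, sq, Finset.sum_mul_sum]
      exact Finset.sum_congr rfl fun k _ => Finset.sum_congr rfl fun l _ => by ring
    simp_rw [h1]
    rw [integral_finsetSum _ fun k _ => integrable_finsetSum _ fun l _ => hpp k l]
    refine Finset.sum_congr rfl fun k _ => ?_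
    rw [integral_finsetSum _ fun l _ => hint k l, integral_finsetSum _ fun l _ => hpp k l]
    refine Finset.sum_congr rfl fun l _ => ?_
    rw [integral_const_mul, integral_const_mul, (v k).integral_coeff_mul (v l) hℱ]
  -- The double sum is the form q evaluated on the diagonal, hence nonnegative.
  · refine ae_of_all _ fun z => ?_
    have := (M.q z.2.1 z.2.2).nonneg (∑ k ∈ E, (a k * (v k).coeff z.2.1 z.1 z.2.2) •
      ContinuousLinearMap.adjoint (v k).S g)
    rw [HilbertianSeminorm.form_sum] at this
    refine this.trans_eq ?_
    exact Finset.sum_congr rfl fun k _ => Finset.sum_congr rfl fun l _ => by ring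

/-- The isometry for combinations of elementary integrands. -/
theorem lintegral_sum_process [TopologicalSpace.SeparableSpace G]
    (hℱ : UsualConditions P ℱ) (r : Iic T) :
    ∫⁻ ω, ‖(∑ k ∈ E, a k • (v k).process) r ω‖ₑ ^ 2 ∂P
      = M.energy (∑ k ∈ E, a k • (v k).family) r := by
  -- Taking Hilbert–Schmidt norms through the adjoint allows one basis of G for all (r, ω, u). As it
  -- is countable, it also yields the measurability needed for Tonelli.
  obtain ⟨w, b, -⟩ := exists_hilbertBasis ℝ G
  have := b.countable_index
  have h1 : ∀ᵐ ω ∂P, ‖(∑ k ∈ E, a k • (v k).process) r ω‖ₑ ^ 2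
      = ∑' i, ‖∑ k ∈ E, a k * (v k).proj r (b i) ω‖ₑ ^ 2 := by
    have hae : ∀ᵐ ω ∂P, ∀ i, ∀ k ∈ E, ⟪(v k).process r ω, b i⟫ = (v k).proj r (b i) ω :=
      ae_all_iff.2 fun i => (Finset.eventually_all E).2 fun k _ => (v k).inner_process r (b i)
    filter_upwards [hae] with ω hω
    rw [enorm_sq_eq_tsum_inner b]
    refine tsum_congr fun i => ?_
    congr 2
    simp only [Finset.sum_apply, Pi.smul_apply, sum_inner, inner_smul_left,
      RCLike.conj_to_real]
    exact Finset.sum_congr rfl fun k hk => by rw [hω i k hk]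
  have hpm : ∀ i, AEMeasurable (fun ω => ‖∑ k ∈ E, a k * (v k).proj r (b i) ω‖ₑ ^ 2) P := fun i =>
    (memLp_finsetSum E fun k _ =>
      ((v k).memLp_proj r (b i)).const_mul (a k)).1.enorm.pow_const 2
  have hm : ∀ i, Measurable fun z : Ω × (ℝ≥0 × U) => ‖ContinuousLinearMap.adjoint
      ((∑ k ∈ E, a k • (v k).family) z.2.1 z.1 z.2.2) (b i)‖ₑ ^ 2 := fun i =>
    measurable_adjoint_sum_family E a v (b i)
  rw [lintegral_congr_ae h1, lintegral_tsum hpm]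
  simp_rw [← lintegral_adjoint_sum_family E a v hℱ]
  rw [← lintegral_tsum fun i => (hm i).aemeasurable, energyMeasure,
    lintegral_prod _ (Measurable.tsum hm).aemeasurable, energy]
  refine lintegral_congr fun ω => ?_
  refine (lintegral_prod _ ((Measurable.tsum hm).comp
    (measurable_prodMk_left (x := ω))).aemeasurable).trans ?_
  simp only [Function.comp_apply]
  simp_rw [hsNormSq_eq_tsum_adjoint b]

end Elementary

end CylMartingaleMeasure

/-- Needed because refining a representation adds up the operators of the active terms. -/
theorem IsHilbertSchmidt.finset_sum {E F κ : Type*} [NormedAddCommGroup E] [InnerProductSpace ℝ E]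
    [CompleteSpace E] [NormedAddCommGroup F] [InnerProductSpace ℝ F] (J : Finset κ)
    {S : κ → E →L[ℝ] F} (hS : ∀ k, IsHilbertSchmidt (S k)) : IsHilbertSchmidt (∑ k ∈ J, S k) := by
  classical
  induction J using Finset.induction_on with
  | empty => simpa using IsHilbertSchmidt.zero
  | insert k J hk ih =>
    rw [Finset.sum_insert hk]
    have key : ∀ x y : ℝ≥0∞, (x + y) ^ 2 ≤ 2 * (x ^ 2 + y ^ 2) := fun x y => by
      have := ENNReal.rpow_add_le_mul_rpow_add_rpow x y (one_le_two (α := ℝ))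
      norm_num at this
      exact this
    have hle : hsNormSq (S k + ∑ l ∈ J, S l) ≤ 2 * (hsNormSq (S k) + hsNormSq (∑ l ∈ J, S l)) := by
      simp only [hsNormSq]
      rw [← ENNReal.tsum_add, ← ENNReal.tsum_mul_left]
      refine ENNReal.tsum_le_tsum fun e => ?_
      rw [_root_.add_apply]
      exact (pow_le_pow_left' (enorm_add_le _ _) 2).trans (key _ _)
    exact hle.trans_lt (ENNReal.mul_lt_top (by simp) (ENNReal.add_lt_top.2 ⟨hS k, ih⟩))

namespace CylMartingaleMeasure

variable {Ω : Type*} {mΩ : MeasurableSpace Ω} {P : Measure Ω} {ℱ : Filtration ℝ≥0 mΩ}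
  {H : Type*} [NormedAddCommGroup H] [InnerProductSpace ℝ H] [CompleteSpace H]
  {U : Type*} [TopologicalSpace U] [MeasurableSpace U]
  {M : CylMartingaleMeasure P ℱ H U} {T : ℝ≥0}
  {G : Type*} [NormedAddCommGroup G] [InnerProductSpace ℝ G] [CompleteSpace G]

/-! ### Separated representations -/

namespace SimpleRep

variable (R : M.SimpleRep T G)

/-- The endpoints of the time intervals. -/
def endpoints : Finset ℝ≥0 := Finset.univ.image R.s ∪ Finset.univ.image R.t

theorem s_mem_endpoints (i : Fin R.n) : R.s i ∈ R.endpoints :=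
  Finset.mem_union_left _ (Finset.mem_image_of_mem _ (Finset.mem_univ i))

theorem t_mem_endpoints (i : Fin R.n) : R.t i ∈ R.endpoints :=
  Finset.mem_union_right _ (Finset.mem_image_of_mem _ (Finset.mem_univ i))

theorem le_of_mem_endpoints {x : ℝ≥0} (hx : x ∈ R.endpoints) : x ≤ T := by
  rcases Finset.mem_union.1 hx with h | h <;> obtain ⟨i, -, rfl⟩ := Finset.mem_image.1 h
  · exact (R.lt i).le.trans (R.le i)
  · exact R.le i

/-- Pairs of consecutive endpoints. -/
def Cell : Type :=
  {p : R.endpoints × R.endpoints //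
    (p.1 : ℝ≥0) < p.2 ∧ ∀ x ∈ R.endpoints, ¬((p.1 : ℝ≥0) < x ∧ x < (p.2 : ℝ≥0))}

instance : Fintype R.Cell := by
  classical
  exact inferInstanceAs (Fintype {p : R.endpoints × R.endpoints //
    (p.1 : ℝ≥0) < p.2 ∧ ∀ x ∈ R.endpoints, ¬((p.1 : ℝ≥0) < x ∧ x < (p.2 : ℝ≥0))})

variable {R}

/-- The left endpoint of a cell. -/
def Cell.left (c : R.Cell) : ℝ≥0 := c.1.1

/-- The right endpoint of a cell. -/
def Cell.right (c : R.Cell) : ℝ≥0 := c.1.2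

/-- If two overlapping cells differed, an endpoint of one would lie strictly inside the other. -/
theorem Cell.eq_of_mem {c c' : R.Cell} {r : ℝ≥0} (h : r ∈ Ioc c.left c.right)
    (h' : r ∈ Ioc c'.left c'.right) : c = c' := by
  have key : ∀ {c c' : R.Cell}, r ∈ Ioc c.left c.right → r ∈ Ioc c'.left c'.right →
      c.left ≤ c'.left ∧ c.right ≤ c'.right := by
    intro c c' h h'
    constructor
    · by_contra! hlt
      exact c'.2.2 _ c.1.1.2 ⟨hlt, h.1.trans_le h'.2⟩
    · by_contra! hlt
      exact c.2.2 _ c'.1.2.2 ⟨h.1.trans_le h'.2, hlt⟩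
  have h1 := key h h'
  have h2 := key h' h
  exact Subtype.ext (Prod.ext (Subtype.ext (le_antisymm h1.1 h2.1))
    (Subtype.ext (le_antisymm h1.2 h2.2)))

/-- No endpoint lies inside a cell, so each time interval contains a whole cell or misses it, as can
be read off at its left end. -/
theorem Cell.mem_Ioc_iff {c : R.Cell} {r : ℝ≥0} (h : r ∈ Ioc c.left c.right) (i : Fin R.n) :
    r ∈ Ioc (R.s i) (R.t i) ↔ R.s i ≤ c.left ∧ c.left < R.t i := by
  constructor
  · intro hr
    refine ⟨?_, h.1.trans_le hr.2⟩
    by_contra! hlt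
    exact c.2.2 _ (R.s_mem_endpoints i) ⟨hlt, hr.1.trans_le h.2⟩
  · rintro ⟨h1, h2⟩
    refine ⟨h1.trans_lt h.1, h.2.trans ?_⟩
    by_contra! hlt
    exact c.2.2 _ (R.t_mem_endpoints i) ⟨h2, hlt⟩

/-- The cell runs from the largest endpoint below r to the smallest endpoint that is at least r. -/
theorem exists_cell {i : Fin R.n} {r : ℝ≥0} (hr : r ∈ Ioc (R.s i) (R.t i)) :
    ∃ c : R.Cell, r ∈ Ioc c.left c.right := by
  classical
  have h1 : (R.endpoints.filter (· < r)).Nonempty :=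
    ⟨R.s i, Finset.mem_filter.2 ⟨R.s_mem_endpoints i, hr.1⟩⟩
  have h2 : (R.endpoints.filter (r ≤ ·)).Nonempty :=
    ⟨R.t i, Finset.mem_filter.2 ⟨R.t_mem_endpoints i, hr.2⟩⟩
  obtain ⟨ha, har⟩ := Finset.mem_filter.1 (Finset.max'_mem _ h1)
  obtain ⟨hb, hbr⟩ := Finset.mem_filter.1 (Finset.min'_mem _ h2)
  refine ⟨⟨(⟨_, ha⟩, ⟨_, hb⟩), har.trans_le hbr, fun x hx hlt => ?_⟩, har, hbr⟩
  rcases lt_or_ge x r with h | h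
  · exact absurd (Finset.le_max' _ x (Finset.mem_filter.2 ⟨hx, h⟩)) (not_le.2 hlt.1)
  · exact absurd (Finset.min'_le _ x (Finset.mem_filter.2 ⟨hx, h⟩)) (not_le.2 hlt.2)

variable (R) in
/-- The set of outcomes for which exactly the terms `i ∈ J` are active after time `x`. -/
def activeSet (x : ℝ≥0) (J : Finset (Fin R.n)) : Set Ω :=
  {ω | ∀ i, (R.s i ≤ x ∧ x < R.t i ∧ ω ∈ R.F i) ↔ i ∈ J}

/-- An event F_i matters only when s_i ≤ x, and then it belongs to ℱ x. -/
theorem measurableSet_activeSet (x : ℝ≥0) (J : Finset (Fin R.n)) :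
    MeasurableSet[ℱ x] (R.activeSet x J) := by
  have : R.activeSet x J = ⋂ i, {ω | (R.s i ≤ x ∧ x < R.t i ∧ ω ∈ R.F i) ↔ i ∈ J} := by
    ext ω; simp [activeSet]
  rw [this]
  refine MeasurableSet.iInter fun i => ?_
  by_cases h1 : R.s i ≤ x ∧ x < R.t i
  · have hF : MeasurableSet[ℱ x] (R.F i) := ℱ.mono h1.1 _ (R.meas_F i)
    by_cases h2 : i ∈ J
    · convert hF using 1
      ext ω; simp [h1, h2]
    · convert hF.compl using 1
      ext ω; simp [h1, h2]
  · have : ∀ ω, (R.s i ≤ x ∧ x < R.t i ∧ ω ∈ R.F i) ↔ False := fun ω =>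
      iff_false_intro fun h => h1 ⟨h.1, h.2.1⟩
    simp only [this]
    exact MeasurableSet.const _

theorem activeSet_disjoint (x : ℝ≥0) {J J' : Finset (Fin R.n)} (h : J ≠ J') :
    Disjoint (R.activeSet x J) (R.activeSet x J') := by
  refine Set.disjoint_left.2 fun ω h1 h2 => h (Finset.ext fun i => ?_)
  rw [← h1 i, ← h2 i]

variable (R) in
/-- The representation obtained from consecutive endpoints and from the sets of active terms. -/
def refine : M.SimpleRep T G :=
  let k := Fintype.equivFin (R.Cell × Finset (Fin R.n))
  { n := Fintype.card (R.Cell × Finset (Fin R.n))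
    m := R.m
    s := fun i => (k.symm i).1.left
    t := fun i => (k.symm i).1.right
    F := fun i => R.activeSet (k.symm i).1.left (k.symm i).2
    A := R.A
    S := fun i j => ∑ l ∈ (k.symm i).2, R.S l j
    lt := fun i => (k.symm i).1.2.1
    le := fun i => R.le_of_mem_endpoints (k.symm i).1.1.2.2
    meas_F := fun _ => measurableSet_activeSet _ _
    mem_A := R.mem_A
    hs := fun _ j => IsHilbertSchmidt.finset_sum _ fun l => R.hs l j }

theorem isSeparated_refine : R.refine.IsSeparated := by
  intro a b hab hne
  set k := Fintype.equivFin (R.Cell × Finset (Fin R.n)) with hk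
  obtain ⟨r, h1, h2⟩ := hne
  have hc : (k.symm a).1 = (k.symm b).1 := Cell.eq_of_mem h1 h2
  refine ⟨?_, ?_⟩
  · change Ioc (k.symm a).1.left (k.symm a).1.right = Ioc (k.symm b).1.left (k.symm b).1.right
    rw [hc]
  · change Disjoint (R.activeSet (k.symm a).1.left (k.symm a).2)
      (R.activeSet (k.symm b).1.left (k.symm b).2)
    rw [hc]
    refine activeSet_disjoint _ fun hJ => hab ?_
    exact k.symm.injective (Prod.ext hc hJ)

/-- A time covered by some cell lies in exactly one, and there ω selects exactly one set J of active
terms; the refined operator is the sum over J, which is what the original terms contribute. Outside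
all cells both sides are zero. -/
theorem toFamily_refine : R.refine.toFamily = R.toFamily := by
  classical
  funext r ω u
  set k := Fintype.equivFin (R.Cell × Finset (Fin R.n)) with hk
  set W : Fin R.n → (M.q r u).Space →L[ℝ] G := fun i => ∑ j, (R.A j).indicator (1 : U → ℝ) u •
    (R.S i j).comp (ContinuousLinearMap.adjoint (M.q r u).incl) with hW
  have hR : R.toFamily r ω u = ∑ i, ((Ioc (R.s i) (R.t i)).indicator (1 : ℝ≥0 → ℝ) r
      * (R.F i).indicator (1 : Ω → ℝ) ω) • W i := by
    simp only [toFamily, hW, Finset.smul_sum, smul_smul]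
  have hR' : R.refine.toFamily r ω u = ∑ c : R.Cell, ∑ J : Finset (Fin R.n),
      ((Ioc c.left c.right).indicator (1 : ℝ≥0 → ℝ) r
        * (R.activeSet c.left J).indicator (1 : Ω → ℝ) ω) • ∑ i ∈ J, W i := by
    rw [← Fintype.sum_prod_type', ← k.symm.sum_comp]
    simp only [toFamily]
    refine Finset.sum_congr rfl fun i _ => ?_
    change (∑ j, ((Ioc (k.symm i).1.left (k.symm i).1.right).indicator (1 : ℝ≥0 → ℝ) r
      * (R.activeSet (k.symm i).1.left (k.symm i).2).indicator (1 : Ω → ℝ) ω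
      * (R.A j).indicator (1 : U → ℝ) u) •
        (∑ l ∈ (k.symm i).2, R.S l j).comp (ContinuousLinearMap.adjoint (M.q r u).incl)) = _
    simp only [hW, ContinuousLinearMap.finsetSum_comp]
    rw [Finset.sum_comm (s := (k.symm i).2)]
    simp only [Finset.smul_sum, smul_smul]
  rw [hR, hR']
  by_cases hc : ∃ c : R.Cell, r ∈ Ioc c.left c.right
  · obtain ⟨c, hc⟩ := hc
    rw [Finset.sum_eq_single c]
    · set J : Finset (Fin R.n) :=
        Finset.univ.filter fun i => R.s i ≤ c.left ∧ c.left < R.t i ∧ ω ∈ R.F i with hJ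
      have hJm : ω ∈ R.activeSet c.left J := fun i => by simp [hJ]
      rw [Finset.sum_eq_single J]
      · rw [indicator_of_mem hc, indicator_of_mem hJm]
        simp only [Pi.one_apply, mul_one, one_smul]
        rw [hJ, Finset.sum_filter]
        refine Finset.sum_congr rfl fun i _ => ?_
        have := Cell.mem_Ioc_iff hc i
        by_cases h1 : r ∈ Ioc (R.s i) (R.t i) <;> by_cases h2 : ω ∈ R.F i
        · rw [if_pos ⟨(this.1 h1).1, (this.1 h1).2, h2⟩, indicator_of_mem h1, indicator_of_mem h2]
          simp
        · rw [if_neg fun h => h2 h.2.2, indicator_of_notMem h2]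
          simp
        · rw [if_neg fun h => h1 (this.2 ⟨h.1, h.2.1⟩), indicator_of_notMem h1]
          simp
        · rw [if_neg fun h => h2 h.2.2, indicator_of_notMem h2]
          simp
      · intro J' _ hne
        have : ω ∉ R.activeSet c.left J' := fun h =>
          Set.disjoint_left.1 (activeSet_disjoint c.left hne) h hJm
        rw [indicator_of_notMem this]
        simp
      · simp
    · intro c' _ hne
      have : r ∉ Ioc c'.left c'.right := fun h => hne (Cell.eq_of_mem h hc)
      rw [indicator_of_notMem this]
      simp
    · simp
  · have h1 : ∀ c : R.Cell, r ∉ Ioc c.left c.right := fun c h => hc ⟨c, h⟩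
    have h2 : ∀ i, r ∉ Ioc (R.s i) (R.t i) := fun i h => hc (exists_cell h)
    simp only [indicator_of_notMem (h1 _), indicator_of_notMem (h2 _)]
    simp

end SimpleRep

/-! ### The integral as a linear relation -/

variable (M T G) in
/-- The linear relation spanned by the pairs of an elementary integrand and its integral process. -/
def integralRelation : Submodule ℝ (M.OpFamily G × (Iic T → Ω → G)) :=
  Submodule.span ℝ (range fun e : M.Elementary T G => (e.family, e.process))

theorem mem_integralRelation_of_isSimpleIntegral {Φ : M.OpFamily G} {X : Iic T → Ω → G}
    (h : M.IsSimpleIntegral T Φ X) : (Φ, X) ∈ M.integralRelation T G := by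
  obtain ⟨R, Y, -, rfl, hY, hX⟩ := h
  let e : Fin R.n → Fin R.m → M.Elementary T G := fun i j =>
    ⟨R.s i, R.t i, R.F i, R.A j, R.S i j, Y i j, R.lt i, R.le i, R.meas_F i, R.mem_A j, hY i j⟩
  have : (R.toFamily, X) = ∑ i, ∑ j, ((e i j).family, (e i j).process) := by
    refine Prod.ext ?_ ?_
    · funext r ω u
      simp only [Prod.fst_sum, Finset.sum_apply]
      rfl
    · funext t ω
      simp only [Prod.snd_sum, Finset.sum_apply]
      exact hX t ω
  rw [this]
  exact Submodule.sum_mem _ fun i _ => Submodule.sum_mem _ fun j _ =>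
    Submodule.subset_span ⟨e i j, rfl⟩

variable [TopologicalSpace.SeparableSpace G] [IsFiniteMeasure P]

theorem mem_l2Martingales_of_mem_integralRelation (hℱ : UsualConditions P ℱ) {Φ : M.OpFamily G}
    {X : Iic T → Ω → G} (h : (Φ, X) ∈ M.integralRelation T G) : X ∈ l2Martingales P ℱ T G := by
  have : M.integralRelation T G ≤ (l2Martingales P ℱ T G).comap (LinearMap.snd ℝ _ _) := by
    rw [integralRelation, Submodule.span_le]
    rintro _ ⟨e, rfl⟩
    exact e.process_mem hℱ
  exact this h

variable [BorelSpace U]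

theorem exists_isSimpleIntegral (hℱ : UsualConditions P ℱ) (hT : 0 < T) {Φ : M.OpFamily G}
    (hΦ : Φ ∈ simpleIntegrands M T G) : ∃ X, M.IsSimpleIntegral T Φ X := by
  obtain ⟨R, rfl⟩ := hΦ
  choose Y hY using fun i j => exists_isRadonified (M := M) hℱ hT (R.refine.s i) (R.refine.t i)
    (R.refine.mem_A j) (R.refine.hs i j)
  exact ⟨_, R.refine, Y, SimpleRep.isSeparated_refine, SimpleRep.toFamily_refine, hY,
    fun _ _ => rfl⟩

/-- The isometry covers all finite combinations of generators, so it holds on the span before the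
relation is known to be single-valued. -/
theorem lintegral_enorm_sq_of_mem_integralRelation (hℱ : UsualConditions P ℱ) {Φ : M.OpFamily G}
    {X : Iic T → Ω → G} (h : (Φ, X) ∈ M.integralRelation T G) (t : Iic T) :
    ∫⁻ ω, ‖X t ω‖ₑ ^ 2 ∂P = M.energy Φ t := by
  obtain ⟨c, hc⟩ := Finsupp.mem_span_range_iff_exists_finsupp.1 h
  have h1 : Φ = ∑ k ∈ c.support, c k • k.family := by
    have := congrArg Prod.fst hc
    simpa [Finsupp.sum, Prod.fst_sum] using this.symm
  have h2 : X = ∑ k ∈ c.support, c k • k.process := by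
    have := congrArg Prod.snd hc
    simpa [Finsupp.sum, Prod.snd_sum] using this.symm
  rw [h1, h2]
  exact Elementary.lintegral_sum_process c.support c id hℱ t

/-- Integral processes of the same integrand are indistinguishable. -/
theorem ae_eq_of_mem_integralRelation (hℱ : UsualConditions P ℱ) (hT : 0 < T) {Φ : M.OpFamily G}
    {X X' : Iic T → Ω → G} (h : (Φ, X) ∈ M.integralRelation T G)
    (h' : (Φ, X') ∈ M.integralRelation T G) : ∀ᵐ ω ∂P, ∀ t, X t ω = X' t ω := by
  have hX := mem_l2Martingales_of_mem_integralRelation hℱ h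
  have hX' := mem_l2Martingales_of_mem_integralRelation hℱ h'
  refine ae_forall_eq_of_forall_ae_eq hT (fun ω t => (hX.1.cadlag ω t).1)
    (fun ω t => (hX'.1.cadlag ω t).1) fun t => ?_
  -- The difference is related to the zero integrand, whose energy is zero.
  have h0 : ((0 : M.OpFamily G), X - X') ∈ M.integralRelation T G := by
    simpa using Submodule.sub_mem _ h h'
  have h1 := lintegral_enorm_sq_of_mem_integralRelation hℱ h0 t
  have h2 : M.energy (0 : M.OpFamily G) t = 0 := by simp [energy, hsNormSq]
  rw [h2] at h1
  have h3 := (lintegral_eq_zero_iff'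
    (((hX.1.memLp t).sub (hX'.1.memLp t)).1.enorm.pow_const 2)).1 h1
  filter_upwards [h3] with ω hω
  simpa [sub_eq_zero] using hω

end CylMartingaleMeasure

end

/-! ### The integral as a continuous linear map -/

theorem mainTheorem3
    {Ω : Type*} {mΩ : MeasurableSpace Ω} (P : Measure Ω) [IsProbabilityMeasure P]
    (ℱ : Filtration ℝ≥0 mΩ) (hℱ : UsualConditions P ℱ)
    {H : Type*} [NormedAddCommGroup H] [InnerProductSpace ℝ H] [CompleteSpace H]
    [TopologicalSpace.SeparableSpace H]
    {G : Type*} [NormedAddCommGroup G] [InnerProductSpace ℝ G] [CompleteSpace G]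
    [TopologicalSpace.SeparableSpace G]
    {U : Type*} [TopologicalSpace U] [MeasurableSpace U] [BorelSpace U]
    (M : CylMartingaleMeasure P ℱ H U) (T : ℝ≥0) (hT : 0 < T) :
    -- the radonified processes exist and are unique up to indistinguishability
    (∀ s t : ℝ≥0, s < t → t ≤ T → ∀ A ∈ M.ring, ∀ S : H →L[ℝ] G, IsHilbertSchmidt S →
      (∃ Y, M.IsRadonified T s t A S Y) ∧
      ∀ Y Y', M.IsRadonified T s t A S Y → M.IsRadonified T s t A S Y' →
        ∀ᵐ ω ∂P, ∀ r, Y r ω = Y' r ω) ∧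
    -- the integral processes define a continuous linear map into `M²_T(G)`
    ∃ I : M.simpleIntegrands T G →ₗ[ℝ] M2 P ℱ T G,
      (∀ Φ : M.simpleIntegrands T G,
        (∃ X, M.IsSimpleIntegral T (Φ : M.OpFamily G) X) ∧
        ∀ X, M.IsSimpleIntegral T (Φ : M.OpFamily G) X →
          (∃ hX : X ∈ l2Martingales P ℱ T G, I Φ = Submodule.Quotient.mk ⟨X, hX⟩) ∧
          ∀ t : Iic T,
            ∫ ω, X t ω ∂P = 0 ∧
            ∫⁻ ω, ‖X t ω‖ₑ ^ 2 ∂P = M.energy (Φ : M.OpFamily G) t) ∧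
      ∃ C : ℝ≥0, ∀ Φ : M.simpleIntegrands T G,
        (I Φ).norm ≤ C * M.lambdaNorm T (Φ : M.OpFamily G) := by
  refine ⟨fun s t _ _ A hA S hS => ⟨M.exists_isRadonified hℱ hT s t hA hS,
    fun Y Y' hY hY' => hY.ae_eq hY' hT⟩, ?_⟩
  choose X hX using fun Φ : M.simpleIntegrands T G => M.exists_isSimpleIntegral hℱ hT Φ.2
  have hrel := fun Φ => M.mem_integralRelation_of_isSimpleIntegral (hX Φ)
  have hmem := fun Φ => M.mem_l2Martingales_of_mem_integralRelation hℱ (hrel Φ)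
  have hmk : ∀ {Φ : M.OpFamily G} {Y Y' : Iic T → Ω → G}, (Φ, Y) ∈ M.integralRelation T G →
      (Φ, Y') ∈ M.integralRelation T G → ∀ (hY : Y ∈ l2Martingales P ℱ T G)
      (hY' : Y' ∈ l2Martingales P ℱ T G),
      (Submodule.Quotient.mk ⟨Y, hY⟩ : M2 P ℱ T G) = Submodule.Quotient.mk ⟨Y', hY'⟩ := by
    intro Φ Y Y' h h' hY hY'
    refine (Submodule.Quotient.eq _).2 ?_
    filter_upwards [M.ae_eq_of_mem_integralRelation hℱ hT h h'] with ω hω t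
    exact sub_eq_zero.2 (hω t)
  -- The chosen processes need not be additive in Φ, but X (Φ + Ψ) and X Φ + X Ψ are both related to
  -- Φ + Ψ, so their classes agree; likewise for scalar multiples.
  let I : M.simpleIntegrands T G →ₗ[ℝ] M2 P ℱ T G :=
    { toFun := fun Φ => Submodule.Quotient.mk ⟨X Φ, hmem Φ⟩
      map_add' := fun Φ Ψ => hmk (hrel (Φ + Ψ)) (Submodule.add_mem _ (hrel Φ) (hrel Ψ)) _
        (Submodule.add_mem _ (hmem Φ) (hmem Ψ))
      map_smul' := fun a Φ => hmk (hrel (a • Φ)) (Submodule.smul_mem _ a (hrel Φ)) _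
        (Submodule.smul_mem _ a (hmem Φ)) }
  -- The constant 2 is the square root of Doob's constant 4.
  refine ⟨I, fun Φ => ⟨⟨X Φ, hX Φ⟩, fun Y hY => ?_⟩, 2, fun Φ => ?_⟩
  · have hYrel := M.mem_integralRelation_of_isSimpleIntegral hY
    have hYmem := M.mem_l2Martingales_of_mem_integralRelation hℱ hYrel
    exact ⟨⟨hYmem, hmk (hrel Φ) hYrel _ _⟩, fun t =>
      ⟨hYmem.2 t, M.lintegral_enorm_sq_of_mem_integralRelation hℱ hYrel t⟩⟩
  · have hdoob := lintegral_iSup_enorm_sq_le hT (hmem Φ).1.martingale (hmem Φ).1.memLp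
      fun ω t => ((hmem Φ).1.cadlag ω t).1
    rw [M.lintegral_enorm_sq_of_mem_integralRelation hℱ (hrel Φ)] at hdoob
    change (∫⁻ ω, ⨆ t, ‖X Φ t ω‖ₑ ^ 2 ∂P) ^ (1 / 2 : ℝ) ≤ _
    refine (ENNReal.rpow_le_rpow hdoob (by norm_num)).trans_eq ?_
    rw [ENNReal.mul_rpow_of_nonneg _ _ (by norm_num), CylMartingaleMeasure.lambdaNorm]
    congr 1
    rw [show (4 : ℝ≥0∞) = 2 ^ (2 : ℝ) by norm_num, ← ENNReal.rpow_mul]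
    norm_num
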